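/- Let $\Bbbk$ be a field and $\mathcal I$ a countable alphabet containing the natural numbers. *Wiring diagrams.* An oriented wiring diagram with inputs $(A_i^{\mathrm{out}};A_i^{\mathrm{in}})$, $1\le i\le r$, and output labels $A_0^{\mathrm{out}},A_0^{\mathrm{in}}$ (finite subsets of $\mathcal I$) is a compact oriented $1$-manifold, up to orientation-preserving homeomorphism, with its beginning points labelled bijectively by $\bigsqcup_{i\ge 0}A_i^{\mathrm{out}}$ and its ending points by $\bigsqcup_{i\ge 0}A_i^{\mathrm{in}}$; equivalently, a bijection $\bigsqcup_i A_i^{\mathrm{out}}\to\bigsqcup_i A_i^{\mathrm{in}}$ together with a number $l\ge 0$ of circles. The composite $D\circ_i D'$, defined when $A_i^{\mathrm{out}/\mathrm{in}}=B_0^{\mathrm{in}/\mathrm{out}}$, glues the output of $D'$ to the $i$-th input of $D$. An *oriented circuit algebra* is a family of $\Bbbk$-vector spaces $V[S;T]$, for finite $S,T\subseteq\mathcal I$, with linear maps $F_D:\bigotimes_{i=1}^r V[A_i^{\mathrm{out}};A_i^{\mathrm{in}}]\to V[A_0^{\mathrm{in}};A_0^{\mathrm{out}}]$ for all wiring diagrams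 $D$, compatible with compositions, identity diagrams and renumbering of inputs. Morphisms are families of linear maps commuting with all $F_D$. This is the category $\mathsf{CA}$. *Planar tangles.* An oriented planar tangle of type $(s_1,\dots,s_r;s_0)$, where the $s_i$ are finite sequences of signs $\pm1$, is a compact oriented $1$-manifold properly embedded in a disc with $r$ numbered round holes, its boundary mapped bijectively to equidistant numbered marked points on the circles, labelled by the $s_i$ ($s_0$ on the outer circle); ending points go to positive and beginning points to negative marked points. Tangles are composed by shrinking and gluing one into a hole of another, with marked points and orientations matching (so the outer sequence of the inner tangle is the negative of the sequence on the hole). An *oriented planar algebra* is a family of $\Bbbk$-vector spaces $A(s)$ indexed by sign sequences, with linear maps $A(s_1)\otimes\dots\otimes A(s_r)\to A(-s_0)$ for all planar tangles, depending only on the isotopy class of the tangle (holes may move, the outer circle is fixed) and compatible with compositions, identity tangles and renumbering of holes. Morphisms are families of linear maps commuting with all these operations. This is the category $\mathsf{PA}$. Every planar tangle $T$ has an underlying wiring diagram $\phi(T)$, obtained by forgetting the embedding, with $A_i^{\mathrm{in}}=\{j: s_{i,j}=1\}$ and $A_i^{\mathrm{out}}=\{j: s_{i,j}=-1\}$. **Proposition.**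 Composable planar tangles have a composite planar tangle. The diagram $\phi(T)$ depends only on the isotopy class of $T$, and $\phi$ is compatible with identities, with the compositions $\circ_i$ and with the symmetric group actions. Consequently every circuit algebra $V$ has an underlying planar algebra $\phi^*V$, with $(\phi^*V)(s)=V[\{j:s_j=-1\};\{j:s_j=1\}]$ and each tangle $T$ acting by $F_{\phi(T)}$; and the resulting restriction functor $\phi^*:\mathsf{CA}\to\mathsf{PA}$ has a left adjoint $\phi_!$, so that there is an adjunction $$\phi_!:\mathsf{PA}\rightleftarrows\mathsf{CA}:\phi^*.$$ -/

import Mathlib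

open CategoryTheory
open scoped unitInterval

universe w u

/-! ### Colours -/

/-- A finite sequence of signs `±1`. -/
structure SignSeq where
  len : ℕ
  sign : Fin len → ℤˣ

/-- A pair `(S^out; S^in)` of finite sets of labels from the alphabet `L`. The two sets need not be
disjoint. -/
@[ext]
structure LabelPair (L : Type) where
  out : Finset L
  inn : Finset L

/-! ### Splitting off the points along which two diagrams are glued -/

section Split

variable {C ι κ : Type} (F : C → Type) (O O' : Type) (c : ι → C) (i : ι) (c' : κ → C)

/-- `O ⊕ Σ j, F (c j)` are the boundary points (of one orientation) of a diagram with outer boundary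
points `O` and inputs `ι`, and `O' ⊕ Σ k, F (c' k)` those of a second diagram, which is to be glued
into the input `i` of the first. A boundary point of either is a boundary point of the composite,
whose inputs are `{j // j ≠ i} ⊕ κ`, or lies on the `i`-th circle of the first diagram (`F (c i)`),
or on the outer circle of the second (`O'`). -/
def splitMap :
    (O ⊕ Σ z : {j // j ≠ i} ⊕ κ, F (Sum.elim (fun j => c j.1) c' z)) ⊕ (F (c i) ⊕ O') →
      (O ⊕ Σ j, F (c j)) ⊕ (O' ⊕ Σ m, F (c' m))
  | .inl (.inl a) => .inl (.inl a)
  | .inl (.inr ⟨.inl j, a⟩) => .inl (.inr ⟨j.1, a⟩)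
  | .inl (.inr ⟨.inr m, a⟩) => .inr (.inr ⟨m, a⟩)
  | .inr (.inl a) => .inl (.inr ⟨i, a⟩)
  | .inr (.inr b) => .inr (.inl b)

theorem splitMap_bijective : Function.Bijective (splitMap F O O' c i c') := by
  constructor
  · rintro ((a | ⟨⟨j, hj⟩ | m, a⟩) | (a | b)) ((a' | ⟨⟨j', hj'⟩ | m', a'⟩) | (a' | b')) h <;>
      simp only [splitMap, Sum.inl.injEq, Sum.inr.injEq, reduceCtorEq] at h
    · rw [h]
    · obtain ⟨h1, h2⟩ := Sigma.mk.inj h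
      subst h1
      rw [eq_of_heq h2]
    · exact absurd (Sigma.mk.inj h).1 hj
    · obtain ⟨h1, h2⟩ := Sigma.mk.inj h
      subst h1
      rw [eq_of_heq h2]
    · exact absurd (Sigma.mk.inj h).1.symm hj'
    · rw [eq_of_heq (Sigma.mk.inj h).2]
    · rw [h]
  · rintro ((a | ⟨j, a⟩) | (b | ⟨m, a⟩))
    · exact ⟨.inl (.inl a), rfl⟩
    · by_cases hj : j = i
      · subst hj
        exact ⟨.inr (.inl a), rfl⟩
      · exact ⟨.inl (.inr ⟨.inl ⟨j, hj⟩, a⟩), rfl⟩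
    · exact ⟨.inr (.inr b), rfl⟩
    · exact ⟨.inl (.inr ⟨.inr m, a⟩), rfl⟩

noncomputable def splitEquiv :
    (O ⊕ Σ z : {j // j ≠ i} ⊕ κ, F (Sum.elim (fun j => c j.1) c' z)) ⊕ (F (c i) ⊕ O') ≃
      (O ⊕ Σ j, F (c j)) ⊕ (O' ⊕ Σ m, F (c' m)) :=
  Equiv.ofBijective _ (splitMap_bijective F O O' c i c')

end Split

/-! ### Gluing oriented intervals end to end

`q : X ⊕ G ≃ Y ⊕ G` describes a finite union of oriented intervals: every interval begins at an
element `z` of `X ⊕ G` and ends at `q z`. Each `g : G` is at the same time the ending point of one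
interval and the beginning point of one interval, and these are glued. What results is a union of
intervals that begin in `X` and end in `Y`, and of circles. -/

section Gluing

variable {X Y G : Type} (q : X ⊕ G ≃ Y ⊕ G)

/-- The interval that begins at `z` is followed by the interval that begins at `z'`. -/
def GlueStep (z z' : X ⊕ G) : Prop := ∃ g, q z = Sum.inr g ∧ z' = Sum.inr g

/-- The glued interval that begins at `x` ends at `y`. -/
def GlueLeads (x : X) (y : Y) : Prop :=
  ∃ z, Relation.ReflTransGen (GlueStep q) (Sum.inl x) z ∧ q z = Sum.inl y

theorem glueLeads_unique {x : X} {y y' : Y} (h : GlueLeads q x y) (h' : GlueLeads q x y') :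
    y = y' := by
  obtain ⟨z, hz, hy⟩ := h
  obtain ⟨z', hz', hy'⟩ := h'
  have hu : Relator.RightUnique (GlueStep q) := by
    rintro a b b' ⟨g, hg, rfl⟩ ⟨g', hg', rfl⟩
    rw [hg] at hg'
    exact congrArg _ (Sum.inr_injective hg')
  have key : z = z' := by
    rcases Relation.ReflTransGen.total_of_right_unique hu hz hz' with h | h
    · rcases Relation.ReflTransGen.cases_head h with h | ⟨_, ⟨g, hg, _⟩, _⟩
      · exact h
      · rw [hy] at hg; cases hg
    · rcases Relation.ReflTransGen.cases_head h with h | ⟨_, ⟨g, hg, _⟩, _⟩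
      · exact h.symm
      · rw [hy'] at hg; cases hg
  subst key
  rw [hy] at hy'
  exact Sum.inl_injective hy'

theorem glueLeads_exists [Finite G] (x : X) : ∃ y, GlueLeads q x y := by
  by_contra hno
  let R : Set (X ⊕ G) := {z | Relation.ReflTransGen (GlueStep q) (Sum.inl x) z}
  have hR : R ⊆ insert (Sum.inl x) (Set.range Sum.inr) := by
    intro z hz
    rcases Relation.ReflTransGen.cases_tail hz with h | ⟨_, _, g, _, rfl⟩
    · exact Or.inl h
    · exact Or.inr ⟨g, rfl⟩
  have hfin : Finite R := ((Set.finite_range _).insert _).subset hR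
  have hex : ∀ z : R, ∃ g : G, q z.1 = Sum.inr g := by
    rintro ⟨z, hz⟩
    rcases hq : q z with y | g
    · exact absurd ⟨y, z, hz, hq⟩ hno
    · exact ⟨g, rfl⟩
  choose f hf using hex
  let F : R → R := fun z => ⟨Sum.inr (f z), Relation.ReflTransGen.tail z.2 ⟨f z, hf z, rfl⟩⟩
  have hF : Function.Injective F := by
    intro a b hab
    have h1 : f a = f b := Sum.inr_injective (congrArg Subtype.val hab)
    apply Subtype.ext
    apply q.injective
    rw [hf a, hf b, h1]
  obtain ⟨a, ha⟩ := (Finite.injective_iff_surjective.mp hF) ⟨Sum.inl x, Relation.ReflTransGen.refl⟩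
  have := congrArg Subtype.val ha
  simp [F] at this

theorem glueLeads_symm {x : X} {y : Y} (h : GlueLeads q x y) : GlueLeads q.symm y x := by
  obtain ⟨z, hz, hy⟩ := h
  have key : ∀ z', Relation.ReflTransGen (GlueStep q) (Sum.inl x) z' →
      ∃ w, Relation.ReflTransGen (GlueStep q.symm) (q z') w ∧ q.symm w = Sum.inl x := by
    intro z' hz'
    induction hz' with
    | refl => exact ⟨_, Relation.ReflTransGen.refl, by simp⟩
    | @tail b b' hb hstep ih =>
      obtain ⟨g, hg, rfl⟩ := hstep
      obtain ⟨w, hw, hwx⟩ := ih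
      refine ⟨w, Relation.ReflTransGen.head ⟨g, by simp, hg⟩ hw, hwx⟩
  obtain ⟨w, hw, hwx⟩ := key z hz
  rw [hy] at hw
  exact ⟨w, hw, hwx⟩

/-- The perfect matching given by the intervals that result from the gluing. -/
noncomputable def glueMatching [Finite G] : X ≃ Y where
  toFun x := (glueLeads_exists q x).choose
  invFun y := (glueLeads_exists q.symm y).choose
  left_inv x := glueLeads_unique q.symm (glueLeads_exists q.symm _).choose_spec
    (glueLeads_symm q (glueLeads_exists q x).choose_spec)
  right_inv y := glueLeads_unique q (glueLeads_exists q _).choose_spec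
    (glueLeads_symm q.symm (glueLeads_exists q.symm y).choose_spec)

/-- The number of circles that result from the gluing: the number of connected components of glued
points from which no free ending point is reached. -/
noncomputable def glueCircles : ℕ :=
  Nat.card {K : Quot (fun g g' : G => q (Sum.inr g) = Sum.inr g') //
    ∀ g, Quot.mk _ g = K → ∀ y, q (Sum.inr g) ≠ Sum.inl y}

end Gluing

/-! ### Oriented wiring diagrams -/

section Wiring

variable {L ι κ : Type}

/-- The labels of the beginning points. A diagram with input label sets `A_j^out, A_j^in` (`j : ι`)
and output label sets `A_0^out, A_0^in` is given the inputs `c j = (A_j^out; A_j^in)` and the output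
`c₀ = (A_0^in; A_0^out)`, so that `c₀` is the pair which indexes the target of the associated
linear map, and so that a diagram can be glued into the input `j` when its output is `c j`. -/
abbrev BeginLabel (c : ι → LabelPair L) (c₀ : LabelPair L) : Type :=
  c₀.inn ⊕ Σ j, (c j).out

/-- The labels of the ending points. -/
abbrev EndLabel (c : ι → LabelPair L) (c₀ : LabelPair L) : Type :=
  c₀.out ⊕ Σ j, (c j).inn

/-- An oriented wiring diagram. A compact oriented `1`-manifold whose components are intervals and
circles, with its beginning and ending points labelled bijectively, is up to orientation-preserving
homeomorphism the same as a perfect matching of the labels (each interval matches its beginning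
point with its ending point) and the number of circles. -/
@[ext]
structure WiringDiagram (c : ι → LabelPair L) (c₀ : LabelPair L) where
  matching : BeginLabel c c₀ ≃ EndLabel c c₀
  circles : ℕ

namespace WiringDiagram

variable {c : ι → LabelPair L} {c₀ : LabelPair L}

/-- The identity diagram with one input. -/
def id (a : LabelPair L) : WiringDiagram (fun _ : Fin 1 => a) a where
  matching :=
    { toFun := Sum.elim (fun x => .inr ⟨0, x⟩) (fun x => .inl x.2)
      invFun := Sum.elim (fun x => .inr ⟨0, x⟩) (fun x => .inl x.2)
      left_inv := by
        rintro (x | ⟨j, x⟩)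
        · rfl
        · obtain rfl := Subsingleton.elim j 0
          rfl
      right_inv := by
        rintro (x | ⟨j, x⟩)
        · rfl
        · obtain rfl := Subsingleton.elim j 0
          rfl }
  circles := 0

/-- Renumbering the inputs. -/
def reindex (D : WiringDiagram c c₀) (e : ι ≃ κ) : WiringDiagram (fun j => c (e.symm j)) c₀ where
  matching :=
    ((Equiv.refl _).sumCongr (e.symm.sigmaCongrLeft (β := fun j => (c j).out))).trans
      (D.matching.trans
        ((Equiv.refl _).sumCongr (e.symm.sigmaCongrLeft (β := fun j => (c j).inn))).symm)
  circles := D.circles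

/-- The intervals of two diagrams `D` and `D'` as seen by the gluing of the outer circle of `D'` to
the `i`-th circle of `D`. The glued points are the elements of `A_i^out ⊔ A_i^in`. -/
noncomputable def gluingData (D : WiringDiagram c c₀) (i : ι) {c' : κ → LabelPair L}
    (D' : WiringDiagram c' (c i)) :
    BeginLabel (Sum.elim (fun j : {j // j ≠ i} => c j.1) c') c₀ ⊕ ((c i).out ⊕ (c i).inn) ≃
      EndLabel (Sum.elim (fun j : {j // j ≠ i} => c j.1) c') c₀ ⊕ ((c i).out ⊕ (c i).inn) :=
  (splitEquiv (fun a : LabelPair L => a.out) c₀.inn (c i).inn c i c').trans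
    ((D.matching.sumCongr D'.matching).trans
      ((splitEquiv (fun a : LabelPair L => a.inn) c₀.out (c i).out c i c').symm.trans
        ((Equiv.refl _).sumCongr (Equiv.sumComm _ _))))

/-- The composite `D ∘_i D'`. -/
noncomputable def comp (D : WiringDiagram c c₀) (i : ι) {c' : κ → LabelPair L}
    (D' : WiringDiagram c' (c i)) :
    WiringDiagram (Sum.elim (fun j : {j // j ≠ i} => c j.1) c') c₀ where
  matching := glueMatching (D.gluingData i D')
  circles := D.circles + D'.circles + glueCircles (D.gluingData i D')

/-- Transport along an equality of input label sets. -/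
def cast {c₁ c₂ : ι → LabelPair L} (h : c₁ = c₂) (D : WiringDiagram c₁ c₀) :
    WiringDiagram c₂ c₀ := h ▸ D

end WiringDiagram

end Wiring

/-! ### Oriented planar tangles -/

/-- The unit disc of the complex plane with numbered round holes. The `i`-th hole is the image of
the unit disc under the similarity `w ↦ center i + scale i * w`, which also fixes where the
numbering of the marked points on its boundary starts. -/
structure HoledDisc (ι : Type) where
  center : ι → ℂ
  scale : ι → ℂ
  scale_ne_zero : ∀ i, scale i ≠ 0
  hole_subset : ∀ i, Metric.closedBall (center i) ‖scale i‖ ⊆ Metric.ball 0 1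
  hole_disjoint : Pairwise fun i j =>
    Disjoint (Metric.closedBall (center i) ‖scale i‖) (Metric.closedBall (center j) ‖scale j‖)

namespace HoledDisc

variable {ι : Type} (H : HoledDisc ι)

/-- The similarity that places the unit disc into the `i`-th hole. -/
def hole (i : ι) (z : ℂ) : ℂ := H.center i + H.scale i * z

/-- The disc with holes, without its boundary circles. -/
def interior : Set ℂ := {z | ‖z‖ < 1 ∧ ∀ i, ‖H.scale i‖ < dist z (H.center i)}

end HoledDisc

/-- The `j`-th of `d` equidistant points on the unit circle. -/
noncomputable def markedPoint {d : ℕ} (j : Fin d) : ℂ :=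
  Complex.exp (2 * Real.pi * Complex.I / d) ^ (j : ℕ)

theorem markedPoint_injective {d : ℕ} : Function.Injective (markedPoint : Fin d → ℂ) := by
  intro j j' h
  have hd : d ≠ 0 := fun hd => by subst hd; exact j.elim0
  exact Fin.ext ((Complex.isPrimitiveRoot_exp d hd).pow_inj j.2 j'.2 h)

theorem norm_markedPoint {d : ℕ} (j : Fin d) : ‖markedPoint j‖ = 1 := by
  have hd : d ≠ 0 := fun hd => by subst hd; exact j.elim0
  rw [markedPoint, norm_pow, (Complex.isPrimitiveRoot_exp d hd).norm'_eq_one hd, one_pow]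

section Tangle

variable {ι κ : Type}

/-- The marked points at which a strand begins. On the inner circles these are the negative ones.
The colour `s₀` of the output is, as for wiring diagrams, the one that has to agree with the colour
of the input circle into which the tangle is glued, so that strands begin at its positive points. -/
abbrev BeginMark (s : ι → SignSeq) (s₀ : SignSeq) : Type :=
  {j : Fin s₀.len // s₀.sign j = 1} ⊕ Σ i, {j : Fin (s i).len // (s i).sign j = -1}

/-- The marked points at which a strand ends. -/
abbrev EndMark (s : ι → SignSeq) (s₀ : SignSeq) : Type :=
  {j : Fin s₀.len // s₀.sign j = -1} ⊕ Σ i, {j : Fin (s i).len // (s i).sign j = 1}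

/-- The position of a marked point at which a strand begins. -/
noncomputable def HoledDisc.beginPoint (H : HoledDisc ι) (s : ι → SignSeq) (s₀ : SignSeq) :
    BeginMark s s₀ → ℂ :=
  Sum.elim (fun j => markedPoint j.1) (fun p => H.hole p.1 (markedPoint p.2.1))

/-- The position of a marked point at which a strand ends. -/
noncomputable def HoledDisc.endPoint (H : HoledDisc ι) (s : ι → SignSeq) (s₀ : SignSeq) :
    EndMark s s₀ → ℂ :=
  Sum.elim (fun j => markedPoint j.1) (fun p => H.hole p.1 (markedPoint p.2.1))

/-- An oriented planar tangle with inputs of colours `s i` and output of colour `s₀`: an oriented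
compact `1`-manifold, namely a finite union of oriented intervals and circles, embedded in a disc
with holes so that its beginning (ending) points are mapped bijectively to the marked points
`BeginMark s s₀` (`EndMark s s₀`), and so that all its other points are mapped to the interior of
the disc with holes. The intervals are indexed by the marked points at which they begin. -/
structure PlanarTangle (s : ι → SignSeq) (s₀ : SignSeq) extends HoledDisc ι where
  matching : BeginMark s s₀ ≃ EndMark s s₀
  arc : BeginMark s s₀ → C(I, ℂ)
  circles : ℕ
  loop : Fin circles → C(UnitAddCircle, ℂ)
  arc_zero : ∀ b, arc b 0 = toHoledDisc.beginPoint s s₀ b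
  arc_one : ∀ b, arc b 1 = toHoledDisc.endPoint s s₀ (matching b)
  arc_mem : ∀ b t, t ≠ 0 → t ≠ 1 → arc b t ∈ toHoledDisc.interior
  loop_mem : ∀ l t, loop l t ∈ toHoledDisc.interior
  injective : Function.Injective
    (Sum.elim (fun p : BeginMark s s₀ × I => arc p.1 p.2)
      (fun p : Fin circles × UnitAddCircle => loop p.1 p.2))

namespace PlanarTangle

variable {s : ι → SignSeq} {s₀ : SignSeq}

/-- The image of the `1`-manifold. -/
def support (T : PlanarTangle s s₀) : Set ℂ :=
  (⋃ b, Set.range (T.arc b)) ∪ ⋃ l, Set.range (T.loop l)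

/-- `γ` runs along a strand of the tangle in the direction of its orientation. The set of these
paths is what the tangle is as an oriented submanifold, without its parametrization. -/
def IsPositivePath (T : PlanarTangle s s₀) (γ : I → ℂ) : Prop :=
  (∃ b, ∃ φ : I → I, StrictMono φ ∧ Continuous φ ∧ ∀ t, γ t = T.arc b (φ t)) ∨
    ∃ l, ∃ φ : I → ℝ, StrictMono φ ∧ Continuous φ ∧ ∀ t, γ t = T.loop l (φ t : UnitAddCircle)

/-- Isotopy of tangles: an ambient isotopy of the closed unit disc, fixed on its boundary (and
extended by the identity to the plane), that carries the holes with their marked points to the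
holes with their marked points, and strands to strands with their orientation. -/
def Isotopic (T T' : PlanarTangle s s₀) : Prop :=
  ∃ h : I → ℂ ≃ₜ ℂ, (Continuous fun p : I × ℂ => h p.1 p.2) ∧ h 0 = Homeomorph.refl ℂ ∧
    (∀ t z, 1 ≤ ‖z‖ → h t z = z) ∧
    (∀ i z, ‖z‖ ≤ 1 → h 1 (T.hole i z) = T'.hole i z) ∧
    ∀ γ : I → ℂ, T.IsPositivePath γ ↔ T'.IsPositivePath fun t => h 1 (γ t)

/-- `T''` results from shrinking `T'`, placing it into the `i`-th hole of `T`, and gluing the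
`1`-manifolds there with their orientations. -/
def IsComp (T : PlanarTangle s s₀) (i : ι) {s' : κ → SignSeq} (T' : PlanarTangle s' (s i))
    (T'' : PlanarTangle (Sum.elim (fun j : {j // j ≠ i} => s j.1) s') s₀) : Prop :=
  (∀ j : {j // j ≠ i}, ∀ z, T''.hole (.inl j) z = T.hole j.1 z) ∧
    (∀ m, ∀ z, T''.hole (.inr m) z = T.hole i (T'.hole m z)) ∧
    T''.support = T.support ∪ T.hole i '' T'.support ∧
    (∀ γ, T.IsPositivePath γ → T''.IsPositivePath γ) ∧
    ∀ γ, T'.IsPositivePath γ → T''.IsPositivePath fun t => T.hole i (γ t)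

/-- Renumbering the holes. -/
def reindex (T : PlanarTangle s s₀) (e : ι ≃ κ) : PlanarTangle (fun j => s (e.symm j)) s₀ where
  center j := T.center (e.symm j)
  scale j := T.scale (e.symm j)
  scale_ne_zero j := T.scale_ne_zero _
  hole_subset j := T.hole_subset _
  hole_disjoint _ _ h := T.hole_disjoint (fun h' => h (e.symm.injective h'))
  matching :=
    ((Equiv.refl _).sumCongr
      (e.symm.sigmaCongrLeft (β := fun i => {j : Fin (s i).len // (s i).sign j = -1}))).trans
      (T.matching.trans
        ((Equiv.refl _).sumCongr
          (e.symm.sigmaCongrLeft (β := fun i => {j : Fin (s i).len // (s i).sign j = 1}))).symm)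
  arc b := T.arc ((Equiv.refl _).sumCongr
      (e.symm.sigmaCongrLeft (β := fun i => {j : Fin (s i).len // (s i).sign j = -1})) b)
  circles := T.circles
  loop := T.loop
  arc_zero b := by
    rw [T.arc_zero]
    rcases b with b | ⟨i, b⟩ <;> rfl
  arc_one b := by
    rw [T.arc_one]
    set E := (Equiv.refl {j : Fin s₀.len // s₀.sign j = -1}).sumCongr
      (e.symm.sigmaCongrLeft (β := fun i => {j : Fin (s i).len // (s i).sign j = 1})) with hE
    have key : ∀ y, T.endPoint s s₀ (E y) = Sum.elim (fun j => markedPoint j.1)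
        (fun p : Σ i, {j : Fin (s (e.symm i)).len // (s (e.symm i)).sign j = 1} =>
          T.hole (e.symm p.1) (markedPoint p.2.1)) y := by
      rintro (y | ⟨i, y⟩) <;> rfl
    have := key (E.symm (T.matching ((Equiv.refl _).sumCongr
      (e.symm.sigmaCongrLeft (β := fun i => {j : Fin (s i).len // (s i).sign j = -1})) b)))
    rw [Equiv.apply_symm_apply] at this
    exact this
  arc_mem b t h0 h1 := by
    have := T.arc_mem ((Equiv.refl _).sumCongr
      (e.symm.sigmaCongrLeft (β := fun i => {j : Fin (s i).len // (s i).sign j = -1})) b) t h0 h1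
    exact ⟨this.1, fun i => this.2 _⟩
  loop_mem l t := by
    have := T.loop_mem l t
    exact ⟨this.1, fun i => this.2 _⟩
  injective := by
    have h := T.injective.comp ((Equiv.prodCongr ((Equiv.refl _).sumCongr
      (e.symm.sigmaCongrLeft (β := fun i => {j : Fin (s i).len // (s i).sign j = -1})))
      (Equiv.refl I)).sumCongr (Equiv.refl (Fin T.circles × UnitAddCircle))).injective
    convert h using 1
    funext x
    rcases x with ⟨b, t⟩ | ⟨l, t⟩ <;> rfl

/-- The radial strands of the identity tangle, parametrized from the inside to the outside. -/
noncomputable def radial (z : ℂ) (t : ℝ) : ℂ := ((1 + t) / 2 : ℝ) * z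

theorem radial_inj {z z' : ℂ} (hz : ‖z‖ = 1) (hz' : ‖z'‖ = 1) {t t' : ℝ} (ht : 0 ≤ t) (ht' : 0 ≤ t')
    (h : radial z t = radial z' t') : z = z' ∧ t = t' := by
  have hn := congrArg norm h
  simp only [radial, norm_mul, Complex.norm_real, hz, hz', mul_one, Real.norm_eq_abs] at hn
  rw [abs_of_nonneg (by linarith), abs_of_nonneg (by linarith)] at hn
  have htt : t = t' := by linarith
  subst htt
  refine ⟨mul_left_cancel₀ ?_ h, rfl⟩
  exact Complex.ofReal_ne_zero.mpr (by linarith)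

/-- The identity tangle: the hole is the concentric disc of radius `1/2`, and the strands are radial
segments. -/
noncomputable def id (a : SignSeq) : PlanarTangle (fun _ : Fin 1 => a) a where
  center _ := 0
  scale _ := 1 / 2
  scale_ne_zero _ := by norm_num
  hole_subset _ := Metric.closedBall_subset_ball (by norm_num)
  hole_disjoint i j h := absurd (Subsingleton.elim i j) h
  matching :=
    { toFun := Sum.elim (fun x => .inr ⟨0, x⟩) (fun x => .inl x.2)
      invFun := Sum.elim (fun x => .inr ⟨0, x⟩) (fun x => .inl x.2)
      left_inv := by
        rintro (x | ⟨j, x⟩)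
        · rfl
        · obtain rfl := Subsingleton.elim j 0
          rfl
      right_inv := by
        rintro (x | ⟨j, x⟩)
        · rfl
        · obtain rfl := Subsingleton.elim j 0
          rfl }
  arc := Sum.elim
    (fun j => ⟨fun t => radial (markedPoint j.1) (1 - (t : ℝ)), by unfold radial; fun_prop⟩)
    (fun p => ⟨fun t => radial (markedPoint p.2.1) (t : ℝ), by unfold radial; fun_prop⟩)
  circles := 0
  loop l := l.elim0
  arc_zero := by
    rintro (j | ⟨i, j⟩)
    · simp [radial, HoledDisc.beginPoint]
    · simp [radial, HoledDisc.beginPoint, HoledDisc.hole]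
  arc_one := by
    rintro (j | ⟨i, j⟩)
    · simp [radial, HoledDisc.endPoint, HoledDisc.hole]
    · simp [radial, HoledDisc.endPoint]
  arc_mem := by
    have key : ∀ z : ℂ, ‖z‖ = 1 → ∀ t : ℝ, 0 < t → t < 1 →
        ‖radial z t‖ < 1 ∧ ∀ _ : Fin 1, ‖(1 / 2 : ℂ)‖ < dist (radial z t) 0 := by
      intro z hz t h0 h1
      have : ‖radial z t‖ = (1 + t) / 2 := by
        rw [radial, norm_mul, hz, mul_one, Complex.norm_real, Real.norm_eq_abs,
          abs_of_nonneg (by linarith)]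
      rw [dist_zero_right, this]
      refine ⟨by linarith, fun _ => ?_⟩
      norm_num
      linarith
    rintro (j | ⟨i, j⟩) t h0 h1
    · have h0' := unitInterval.pos_iff_ne_zero.mpr h0
      have h1' := unitInterval.lt_one_iff_ne_one.mpr h1
      exact key _ (norm_markedPoint _) (1 - (t : ℝ)) (sub_pos.mpr h1') (sub_lt_self _ h0')
    · have h0' := unitInterval.pos_iff_ne_zero.mpr h0
      have h1' := unitInterval.lt_one_iff_ne_one.mpr h1
      exact key _ (norm_markedPoint _) t h0' h1'
  loop_mem l := l.elim0
  injective := by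
    rintro (⟨j | ⟨i, j⟩, t⟩ | ⟨l, _⟩) (⟨j' | ⟨i', j'⟩, t'⟩ | ⟨l', _⟩) h
    rotate_left 2
    · exact l'.elim0
    rotate_left 2
    · exact l'.elim0
    · exact l.elim0
    · exact l.elim0
    · exact l.elim0
    · obtain ⟨h1, h2⟩ := radial_inj (norm_markedPoint _) (norm_markedPoint _)
        (sub_nonneg.mpr t.2.2) (sub_nonneg.mpr t'.2.2) h
      obtain rfl : j = j' := Subtype.ext (markedPoint_injective h1)
      obtain rfl : t = t' := Subtype.ext (sub_right_injective h2)
      rfl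
    · obtain ⟨h1, h2⟩ := radial_inj (norm_markedPoint _) (norm_markedPoint _)
        (sub_nonneg.mpr t.2.2) t'.2.1 h
      have h3 : j.1 = j'.1 := markedPoint_injective h1
      have h4 := j.2
      rw [h3, j'.2] at h4
      exact absurd h4 (by decide)
    · obtain ⟨h1, h2⟩ := radial_inj (norm_markedPoint _) (norm_markedPoint _)
        t.2.1 (sub_nonneg.mpr t'.2.2) h
      have h3 : j.1 = j'.1 := markedPoint_injective h1
      have h4 := j.2
      rw [h3, j'.2] at h4
      exact absurd h4 (by decide)
    · obtain ⟨h1, h2⟩ := radial_inj (norm_markedPoint _) (norm_markedPoint _) t.2.1 t'.2.1 h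
      obtain rfl : j = j' := Subtype.ext (markedPoint_injective h1)
      obtain rfl : t = t' := Subtype.ext h2
      obtain rfl := Subsingleton.elim i i'
      rfl

end PlanarTangle

/-! ### The wiring diagram of a planar tangle -/

variable {L : Type}

/-- The labels of those positions in `1, …, d` (numbered here by `Fin d`) that satisfy `P`; the
natural number `n` is the label `ν n`. -/
def labelsOf (ν : ℕ ↪ L) {d : ℕ} (P : Fin d → Prop) [DecidablePred P] : Finset L :=
  (Finset.univ.filter P).map ⟨fun j : Fin d => ν (j + 1), fun j j' h => by
    have := ν.injective h
    exact Fin.ext (by simpa using this)⟩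

noncomputable def labelsOfEquiv (ν : ℕ ↪ L) {d : ℕ} (P : Fin d → Prop) [DecidablePred P] :
    {j // P j} ≃ labelsOf ν P :=
  Equiv.ofBijective
    (fun j => ⟨ν (j.1 + 1), Finset.mem_map.mpr ⟨j.1, by simp [j.2], rfl⟩⟩) <| by
      constructor
      · intro j j' h
        have := ν.injective (congrArg Subtype.val h)
        exact Subtype.ext (Fin.ext (by simpa using this))
      · rintro ⟨x, hx⟩
        obtain ⟨j, hj, rfl⟩ := Finset.mem_map.mp hx
        exact ⟨⟨j, by simpa using hj⟩, rfl⟩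

/-- The pair of label sets `({j : s_j = -1}; {j : s_j = 1})` of a sign sequence `s`. -/
def SignSeq.labels (ν : ℕ ↪ L) (s : SignSeq) : LabelPair L where
  out := labelsOf ν fun j => s.sign j = -1
  inn := labelsOf ν fun j => s.sign j = 1

theorem labels_comp_elim (ν : ℕ ↪ L) (s : ι → SignSeq) (i : ι) (s' : κ → SignSeq) :
    (fun z => (Sum.elim (fun j : {j // j ≠ i} => s j.1) s' z).labels ν) =
      Sum.elim (fun j : {j // j ≠ i} => (s j.1).labels ν) (fun m => (s' m).labels ν) := by
  funext z
  rcases z with z | z <;> rfl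

/-- The label of a marked point at which a strand begins. -/
noncomputable def beginLabelEquiv (ν : ℕ ↪ L) (s : ι → SignSeq) (s₀ : SignSeq) :
    BeginMark s s₀ ≃ BeginLabel (fun i => (s i).labels ν) (s₀.labels ν) :=
  (labelsOfEquiv ν fun j => s₀.sign j = 1).sumCongr
    (Equiv.sigmaCongrRight fun i => labelsOfEquiv ν fun j => (s i).sign j = -1)

/-- The label of a marked point at which a strand ends. -/
noncomputable def endLabelEquiv (ν : ℕ ↪ L) (s : ι → SignSeq) (s₀ : SignSeq) :
    EndMark s s₀ ≃ EndLabel (fun i => (s i).labels ν) (s₀.labels ν) :=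
  (labelsOfEquiv ν fun j => s₀.sign j = -1).sumCongr
    (Equiv.sigmaCongrRight fun i => labelsOfEquiv ν fun j => (s i).sign j = 1)

/-- The wiring diagram of a planar tangle: forget how the `1`-manifold is embedded, and remember
only the labels of its boundary points. -/
noncomputable def PlanarTangle.forget {s : ι → SignSeq} {s₀ : SignSeq} (ν : ℕ ↪ L)
    (T : PlanarTangle s s₀) : WiringDiagram (fun i => (s i).labels ν) (s₀.labels ν) where
  matching := (beginLabelEquiv ν s s₀).symm.trans (T.matching.trans (endLabelEquiv ν s s₀))
  circles := T.circles

end Tangle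

/-! ### Families of vector spaces with operations -/

/-- A family of `k`-vector spaces indexed by a set `C` of colours, with a linear map
`V (c 1) ⊗ ⋯ ⊗ V (c r) → V c₀` for every element of `P c c₀`. -/
structure OperadAction (k : Type u) [Field k] {C : Type}
    (P : ∀ ⦃r : ℕ⦄, (Fin r → C) → C → Type) where
  V : C → ModuleCat.{w} k
  act : ∀ ⦃r : ℕ⦄ ⦃c : Fin r → C⦄ ⦃c₀ : C⦄, P c c₀ →
    MultilinearMap k (fun j => V (c j)) (V c₀)

namespace OperadAction

variable {k : Type u} [Field k] {C : Type} {P : ∀ ⦃r : ℕ⦄, (Fin r → C) → C → Type}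

/-- A family of linear maps that commutes with the operations. -/
@[ext]
structure Hom (A B : OperadAction.{w} k P) where
  app : ∀ c, A.V c →ₗ[k] B.V c
  comm : ∀ ⦃r : ℕ⦄ ⦃c : Fin r → C⦄ ⦃c₀ : C⦄ (D : P c c₀) (x : ∀ j, A.V (c j)),
    app c₀ (A.act D x) = B.act D fun j => app (c j) (x j)

instance : Category (OperadAction.{w} k P) where
  Hom := Hom
  id A := ⟨fun _ => LinearMap.id, fun _ _ _ _ _ => rfl⟩
  comp f g := ⟨fun c => (g.app c).comp (f.app c), fun _ _ _ D x => by
    simp only [LinearMap.comp_apply, f.comm, g.comm]⟩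

end OperadAction

/-- The element `v` at the place `i` and the elements `x j` at the other places. -/
def plug {ι : Type} [DecidableEq ι] {X : ι → Type w} (i : ι) (x : ∀ j : {j // j ≠ i}, X j.1)
    (v : X i) (j : ι) : X j :=
  if h : j = i then h.symm ▸ v else x ⟨j, h⟩

section Algebras

variable (k : Type u) [Field k] (L : Type)

abbrev CircuitAction := OperadAction.{w} k fun _ c c₀ => WiringDiagram (L := L) c c₀

abbrev PlanarAction := OperadAction.{w} k fun _ s s₀ => PlanarTangle s s₀

variable {k L}

/-- The axioms of an oriented circuit algebra. -/
structure IsCircuitAlgebra (A : CircuitAction.{w} k L) : Prop where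
  /-- Identity diagrams act as identities. -/
  unit : ∀ (a : LabelPair L) (x : Fin 1 → A.V a), A.act (WiringDiagram.id a) x = x 0
  /-- `D ∘_i D'`, with its inputs numbered in any way `e`, acts as the composite of the actions. -/
  comp : ∀ {r r' t : ℕ} {c : Fin r → LabelPair L} {c₀ : LabelPair L} (D : WiringDiagram c c₀)
    (i : Fin r) {c' : Fin r' → LabelPair L} (D' : WiringDiagram c' (c i))
    (e : {j // j ≠ i} ⊕ Fin r' ≃ Fin t)
    (x : ∀ z, A.V (Sum.elim (fun j : {j // j ≠ i} => c j.1) c' z)),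
    A.act ((D.comp i D').reindex e) (fun j => x (e.symm j)) =
      A.act D (plug (X := fun j => A.V (c j)) i (fun j => x (.inl j))
        (A.act D' fun m => x (.inr m)))
  /-- Equivariance under renumbering the inputs. -/
  perm : ∀ {r : ℕ} {c : Fin r → LabelPair L} {c₀ : LabelPair L} (D : WiringDiagram c c₀)
    (e : Equiv.Perm (Fin r)) (x : ∀ j, A.V (c j)),
    A.act (D.reindex e) (fun j => x (e.symm j)) = A.act D x

/-- The axioms of an oriented planar algebra. -/
structure IsPlanarAlgebra (A : PlanarAction.{w} k) : Prop where
  /-- The action depends only on the isotopy class of the tangle. -/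
  isotopy : ∀ {r : ℕ} {s : Fin r → SignSeq} {s₀ : SignSeq} (T T' : PlanarTangle s s₀),
    T.Isotopic T' → A.act T = A.act T'
  /-- Identity tangles act as identities. -/
  unit : ∀ (a : SignSeq) (x : Fin 1 → A.V a), A.act (PlanarTangle.id a) x = x 0
  /-- The composite of `T` and `T'`, with its inputs numbered in any way `e`, acts as the composite
  of the actions. -/
  comp : ∀ {r r' t : ℕ} {s : Fin r → SignSeq} {s₀ : SignSeq} (T : PlanarTangle s s₀)
    (i : Fin r) {s' : Fin r' → SignSeq} (T' : PlanarTangle s' (s i))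
    (T'' : PlanarTangle (Sum.elim (fun j : {j // j ≠ i} => s j.1) s') s₀)
    (e : {j // j ≠ i} ⊕ Fin r' ≃ Fin t)
    (x : ∀ z, A.V (Sum.elim (fun j : {j // j ≠ i} => s j.1) s' z)), T.IsComp i T' T'' →
    A.act (T''.reindex e) (fun j => x (e.symm j)) =
      A.act T (plug (X := fun j => A.V (s j)) i (fun j => x (.inl j))
        (A.act T' fun m => x (.inr m)))
  /-- Equivariance under renumbering the inputs. -/
  perm : ∀ {r : ℕ} {s : Fin r → SignSeq} {s₀ : SignSeq} (T : PlanarTangle s s₀)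
    (e : Equiv.Perm (Fin r)) (x : ∀ j, A.V (s j)),
    A.act (T.reindex e) (fun j => x (e.symm j)) = A.act T x

variable (k L)

/-- The category of oriented circuit algebras. -/
abbrev CircuitAlgebra :=
  ObjectProperty.FullSubcategory (IsCircuitAlgebra : CircuitAction.{w} k L → Prop)

/-- The category of oriented planar algebras. -/
abbrev PlanarAlgebra :=
  ObjectProperty.FullSubcategory (IsPlanarAlgebra : PlanarAction.{w} k → Prop)

variable {k L}

/-- Restriction along `forget`: a planar tangle acts through its wiring diagram. -/
noncomputable def restrictAction (ν : ℕ ↪ L) : CircuitAction.{w} k L ⥤ PlanarAction.{w} k where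
  obj A := { V := fun s => A.V (s.labels ν), act := fun _ _ _ T => A.act (T.forget ν) }
  map f := ⟨fun s => f.app (s.labels ν), fun _ _ _ T x => f.comm (T.forget ν) x⟩

/-- The functor `φ^*` from circuit algebras to planar algebras, given that restriction along
`forget` turns circuit algebras into planar algebras. -/
noncomputable def restriction (ν : ℕ ↪ L)
    (h : ∀ A : CircuitAction.{w} k L, IsCircuitAlgebra A →
      IsPlanarAlgebra ((restrictAction ν).obj A)) :
    CircuitAlgebra.{w} k L ⥤ PlanarAlgebra.{w} k :=
  ObjectProperty.lift _ (ObjectProperty.ι _ ⋙ restrictAction ν) fun A => h A.obj A.property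

end Algebras

/-!
A family of disjoint embedded intervals and circles can be recovered from its union and from the
paths that run along it in the positive direction: the union has the strands as its connected
components, and no positive path leaves its strand. A composite of tangles is only known through
these two data, and following positive paths through the glued marked points shows that its
intervals match the free marked points as the gluing of perfect matchings prescribes. Every
component that contains no free marked point is a circle, so counting components gives the number
of circles. An ambient isotopy respects components and positive paths, too. Composites exist because
the intervals can be glued one marked point at a time.

The left adjoint sends a planar algebra to the formal expressions that wiring diagrams and linear
operations form from its elements, two of which are identified if they have the same value in every
circuit algebra to which the planar algebra is mapped.
-/

/-! ### Joining and closing arcs -/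

section Arcs

variable {M : Type*} [TopologicalSpace M]

/-- The increasing map of the unit interval onto its first half. -/
noncomputable def firstHalf (t : I) : I := ⟨t / 2, by constructor <;> linarith [t.2.1, t.2.2]⟩

/-- The increasing map of the unit interval onto its second half. -/
noncomputable def secondHalf (t : I) : I :=
  ⟨(t + 1) / 2, by constructor <;> linarith [t.2.1, t.2.2]⟩

theorem strictMono_firstHalf : StrictMono firstHalf := fun _ _ h =>
  Subtype.mk_lt_mk.mpr (div_lt_div_of_pos_right h two_pos)

theorem strictMono_secondHalf : StrictMono secondHalf := fun _ _ h =>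
  Subtype.mk_lt_mk.mpr <|
    div_lt_div_of_pos_right (add_lt_add_left (Subtype.coe_lt_coe.mpr h) 1) two_pos

theorem continuous_firstHalf : Continuous firstHalf := by
  unfold firstHalf; fun_prop

theorem continuous_secondHalf : Continuous secondHalf := by
  unfold secondHalf; fun_prop

theorem firstHalf_zero : firstHalf 0 = 0 := Subtype.ext (by simp [firstHalf])

theorem secondHalf_one : secondHalf 1 = 1 := Subtype.ext (by norm_num [secondHalf])

theorem firstHalf_one : firstHalf 1 = secondHalf 0 :=
  Subtype.ext (by norm_num [firstHalf, secondHalf])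

theorem eq_firstHalf_or_secondHalf (t : I) : (∃ u, t = firstHalf u) ∨ ∃ u, t = secondHalf u := by
  rcases le_total (t : ℝ) (1 / 2) with h | h
  · exact .inl ⟨⟨2 * t, by constructor <;> linarith [t.2.1]⟩, Subtype.ext (by simp [firstHalf])⟩
  · exact .inr ⟨⟨2 * t - 1, by constructor <;> linarith [t.2.2]⟩,
      Subtype.ext (by simp [secondHalf])⟩

/-- The arc that runs along `c` during the first half of the unit interval and along `c'` during the
second half. -/
noncomputable def joinArc (c c' : C(I, M)) (h : c 1 = c' 0) : C(I, M) :=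
  (Path.trans ⟨c, rfl, rfl⟩ ⟨c', h.symm, rfl⟩ : Path (c 0) (c' 1)).toContinuousMap

theorem joinArc_secondHalf (c c' : C(I, M)) (h : c 1 = c' 0) (t : I) :
    joinArc c c' h (secondHalf t) = c' t := by
  let γ : Path (c 0) (c 1) := ⟨c, rfl, rfl⟩
  let γ' : Path (c 1) (c' 1) := ⟨c', h.symm, rfl⟩
  have ht : (1 / 2 : ℝ) ≤ (t + 1) / 2 := by linarith [t.2.1]
  calc joinArc c c' h (secondHalf t) = (γ.trans γ').extend ((t + 1) / 2) :=
        ((γ.trans γ').extend_apply (secondHalf t).2).symm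
    _ = γ'.extend t := by rw [Path.extend_trans_of_half_le _ _ ht]; congr 1; ring
    _ = c' t := γ'.extend_apply t.2

theorem joinArc_firstHalf (c c' : C(I, M)) (h : c 1 = c' 0) (t : I) :
    joinArc c c' h (firstHalf t) = c t := by
  let γ : Path (c 0) (c 1) := ⟨c, rfl, rfl⟩
  let γ' : Path (c 1) (c' 1) := ⟨c', h.symm, rfl⟩
  have ht : (t : ℝ) / 2 ≤ 1 / 2 := by linarith [t.2.2]
  calc joinArc c c' h (firstHalf t) = (γ.trans γ').extend (t / 2) :=
        ((γ.trans γ').extend_apply (firstHalf t).2).symm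
    _ = γ.extend t := by rw [Path.extend_trans_of_le_half _ _ ht]; congr 1; ring
    _ = c t := γ.extend_apply t.2

theorem joinArc_zero (c c' : C(I, M)) (h : c 1 = c' 0) : joinArc c c' h 0 = c 0 := Path.source _

theorem joinArc_one (c c' : C(I, M)) (h : c 1 = c' 0) : joinArc c c' h 1 = c' 1 := Path.target _

theorem exists_unitInterval_coe_eq (x : UnitAddCircle) :
    ∃ t : I, t ≠ 1 ∧ ((t : ℝ) : UnitAddCircle) = x := by
  let y := AddCircle.equivIco (1 : ℝ) 0 x
  have hy : (y : ℝ) < 1 := y.2.2.trans_eq (zero_add 1)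
  exact ⟨⟨y, y.2.1, hy.le⟩, fun h => hy.ne (congrArg Subtype.val h), AddCircle.coe_equivIco⟩

/-- The loop that runs along the arc `c`, which ends where it begins. -/
noncomputable def closeArc (c : C(I, M)) (h : c 0 = c 1) : C(UnitAddCircle, M) where
  toFun := AddCircle.liftIco 1 0 (Set.IccExtend zero_le_one c)
  continuous_toFun := AddCircle.liftIco_zero_continuous (by simpa using h)
    c.continuous.Icc_extend'.continuousOn

theorem closeArc_coe (c : C(I, M)) (h : c 0 = c 1) (t : I) :
    closeArc c h ((t : ℝ) : UnitAddCircle) = c t := by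
  have lift_eq (u : I) (hu : u ≠ 1) : closeArc c h ((u : ℝ) : UnitAddCircle) = c u :=
    (AddCircle.liftIco_zero_coe_apply (p := (1 : ℝ))
      ⟨u.2.1, unitInterval.lt_one_iff_ne_one.mpr hu⟩).trans (Set.IccExtend_val _ c u)
  rcases eq_or_ne t 1 with rfl | ht
  · rw [← h, ← lift_eq 0 zero_ne_one]
    exact congrArg _ (AddCircle.coe_period 1)
  · exact lift_eq t ht

end Arcs

/-! ### Families of strands and their gluing -/

/-- A family of oriented intervals and circles mapped to a topological space. -/
structure Strands (M : Type*) [TopologicalSpace M] (A Λ : Type*) where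
  arc : A → C(I, M)
  loop : Λ → C(UnitAddCircle, M)

namespace Strands

variable {M : Type*} [TopologicalSpace M] {A Λ A' Λ' A'' Λ'' : Type*}

section Basic

variable (S : Strands M A Λ)

/-- The union of the strands. -/
def support : Set M := (⋃ a, Set.range (S.arc a)) ∪ ⋃ l, Set.range (S.loop l)

/-- The path `γ` runs along a strand in the direction of its orientation; this is
`PlanarTangle.IsPositivePath` for a family of strands. -/
def IsPositivePath (γ : I → M) : Prop :=
  (∃ a, ∃ φ : I → I, StrictMono φ ∧ Continuous φ ∧ ∀ t, γ t = S.arc a (φ t)) ∨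
    ∃ l, ∃ φ : I → ℝ, StrictMono φ ∧ Continuous φ ∧ ∀ t, γ t = S.loop l (φ t : UnitAddCircle)

/-- The beginning points of the intervals. -/
def starts : Set M := Set.range fun a => S.arc a 0

/-- The ending points of the intervals. -/
def ends : Set M := Set.range fun a => S.arc a 1

/-- The strands are embedded and disjoint. -/
structure Embedded : Prop where
  arc_eq : ∀ {a t a' t'}, S.arc a t = S.arc a' t' → a = a' ∧ t = t'
  arc_ne_loop : ∀ a t l u, S.arc a t ≠ S.loop l u
  loop_eq : ∀ {l u l' u'}, S.loop l u = S.loop l' u' → l = l' ∧ u = u'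

/-- The strands are embedded and disjoint, except that the ending point of an interval may be the
beginning point of an interval: these are the strands that can be glued. -/
structure WeaklyEmbedded : Prop where
  arc_eq : ∀ {a t a' t'}, S.arc a t = S.arc a' t' →
    (a = a' ∧ t = t') ∨ (t = 1 ∧ t' = 0) ∨ t = 0 ∧ t' = 1
  arc_ne_loop : ∀ a t l u, S.arc a t ≠ S.loop l u
  loop_eq : ∀ {l u l' u'}, S.loop l u = S.loop l' u' → l = l' ∧ u = u'

/-- The strands of `S'` result from those of `S` by gluing some of the intervals end to end. -/
structure GluesTo (S' : Strands M A' Λ') : Prop where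
  support_eq : S'.support = S.support
  isPositivePath : ∀ {γ}, S.IsPositivePath γ → S'.IsPositivePath γ
  starts_diff : S'.starts \ S'.ends = S.starts \ S.ends
  ends_diff : S'.ends \ S'.starts = S.ends \ S.starts

theorem isPositivePath_arc (a : A) : S.IsPositivePath (S.arc a) :=
  .inl ⟨a, _root_.id, strictMono_id, continuous_id, fun _ => rfl⟩

theorem isPositivePath_loop (l : Λ) :
    S.IsPositivePath fun t : I => S.loop l ((t : ℝ) : UnitAddCircle) :=
  .inr ⟨l, Subtype.val, fun _ _ h => h, continuous_subtype_val, fun _ => rfl⟩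

variable {S}

theorem mem_support_iff {z : M} :
    z ∈ S.support ↔ (∃ a t, S.arc a t = z) ∨ ∃ l u, S.loop l u = z := by
  simp only [support, Set.mem_union, Set.mem_iUnion, Set.mem_range]

theorem Embedded.weaklyEmbedded (h : S.Embedded) : S.WeaklyEmbedded :=
  ⟨fun e => .inl (h.arc_eq e), h.arc_ne_loop, h.loop_eq⟩

theorem WeaklyEmbedded.start_injective (h : S.WeaklyEmbedded) {a a' : A}
    (e : S.arc a 0 = S.arc a' 0) : a = a' := by
  rcases h.arc_eq e with h | h | h
  · exact h.1
  · exact absurd h.1 zero_ne_one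
  · exact absurd h.2 zero_ne_one

theorem WeaklyEmbedded.end_injective (h : S.WeaklyEmbedded) {a a' : A}
    (e : S.arc a 1 = S.arc a' 1) : a = a' := by
  rcases h.arc_eq e with h | h | h
  · exact h.1
  · exact absurd h.2 one_ne_zero
  · exact absurd h.1 one_ne_zero

theorem GluesTo.trans {S' : Strands M A' Λ'} {S'' : Strands M A'' Λ''} (h : S.GluesTo S')
    (h' : S'.GluesTo S'') : S.GluesTo S'' where
  support_eq := h'.support_eq.trans h.support_eq
  isPositivePath hγ := h'.isPositivePath (h.isPositivePath hγ)
  starts_diff := h'.starts_diff.trans h.starts_diff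
  ends_diff := h'.ends_diff.trans h.ends_diff

theorem gluesTo_of_glued_point {S' : Strands M A' Λ'} {p : M}
    (support_eq : S'.support = S.support)
    (isPositivePath : ∀ {γ}, S.IsPositivePath γ → S'.IsPositivePath γ)
    (start_mem : p ∈ S.starts) (end_mem : p ∈ S.ends)
    (starts_eq : S'.starts = S.starts \ {p}) (ends_eq : S'.ends = S.ends \ {p}) :
    S.GluesTo S' where
  support_eq := support_eq
  isPositivePath := isPositivePath
  starts_diff := by
    rw [starts_eq, ends_eq]
    ext x
    simp only [Set.mem_sdiff, Set.mem_singleton_iff]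
    grind
  ends_diff := by
    rw [starts_eq, ends_eq]
    ext x
    simp only [Set.mem_sdiff, Set.mem_singleton_iff]
    grind

end Basic

section Close

variable {S : Strands M A Λ} {a : A}

/-- The interval `a`, which ends where it begins, becomes the circle `none`. -/
noncomputable def close (S : Strands M A Λ) (a : A) (ha : S.arc a 1 = S.arc a 0) :
    Strands M {x // x ≠ a} (Option Λ) where
  arc x := S.arc x
  loop l := l.elim (closeArc (S.arc a) ha.symm) S.loop

theorem exists_loop_close_eq (ha : S.arc a 1 = S.arc a 0) (u : UnitAddCircle) :
    ∃ t : I, t ≠ 1 ∧ ((t : ℝ) : UnitAddCircle) = u ∧ (S.close a ha).loop none u = S.arc a t := by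
  obtain ⟨t, ht, rfl⟩ := exists_unitInterval_coe_eq u
  exact ⟨t, ht, rfl, closeArc_coe _ ha.symm t⟩

theorem WeaklyEmbedded.arc_ne_of_closed (h : S.WeaklyEmbedded) (ha : S.arc a 1 = S.arc a 0) {x : A}
    (hx : x ≠ a) (t u : I) : S.arc x t ≠ S.arc a u := fun e => by
  rcases h.arc_eq e with ⟨e', -⟩ | ⟨rfl, rfl⟩ | ⟨rfl, rfl⟩
  · exact hx e'
  · exact hx (h.end_injective (e.trans ha.symm))
  · exact hx (h.start_injective (e.trans ha))

theorem WeaklyEmbedded.close (h : S.WeaklyEmbedded) (ha : S.arc a 1 = S.arc a 0) :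
    (S.close a ha).WeaklyEmbedded where
  arc_eq e := (h.arc_eq e).imp_left fun e' => ⟨Subtype.ext e'.1, e'.2⟩
  arc_ne_loop := by
    rintro x t (_ | l) u e
    · obtain ⟨v, -, -, hv⟩ := exists_loop_close_eq ha u
      exact h.arc_ne_of_closed ha x.2 t v (e.trans hv)
    · exact h.arc_ne_loop _ _ _ _ e
  loop_eq := by
    rintro (_ | l) u (_ | l') u' e
    · obtain ⟨v, hv, rfl, e₁⟩ := exists_loop_close_eq ha u
      obtain ⟨v', hv', rfl, e₂⟩ := exists_loop_close_eq ha u'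
      rcases h.arc_eq (e₁.symm.trans (e.trans e₂)) with e' | e' | e'
      · exact ⟨rfl, by rw [e'.2]⟩
      · exact absurd e'.1 hv
      · exact absurd e'.2 hv'
    · obtain ⟨v, -, -, hv⟩ := exists_loop_close_eq ha u
      exact absurd (hv.symm.trans e) (h.arc_ne_loop _ _ _ _)
    · obtain ⟨v, -, -, hv⟩ := exists_loop_close_eq ha u'
      exact absurd (hv.symm.trans e.symm) (h.arc_ne_loop _ _ _ _)
    · exact ⟨congrArg some (h.loop_eq e).1, (h.loop_eq e).2⟩

theorem support_close (ha : S.arc a 1 = S.arc a 0) : (S.close a ha).support = S.support := by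
  ext z
  simp only [mem_support_iff]
  constructor
  · rintro (⟨x, t, rfl⟩ | ⟨_ | l, u, rfl⟩)
    · exact .inl ⟨x, t, rfl⟩
    · obtain ⟨v, -, -, hv⟩ := exists_loop_close_eq ha u
      exact .inl ⟨a, v, hv.symm⟩
    · exact .inr ⟨l, u, rfl⟩
  · rintro (⟨x, t, rfl⟩ | ⟨l, u, rfl⟩)
    · rcases eq_or_ne x a with rfl | hx
      · exact .inr ⟨none, _, closeArc_coe _ ha.symm t⟩
      · exact .inl ⟨⟨x, hx⟩, t, rfl⟩
    · exact .inr ⟨some l, u, rfl⟩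

theorem IsPositivePath.close (ha : S.arc a 1 = S.arc a 0) {γ : I → M} (hγ : S.IsPositivePath γ) :
    (S.close a ha).IsPositivePath γ := by
  rcases hγ with ⟨x, φ, hφ, hφ', hγ⟩ | ⟨l, φ, hφ, hφ', hγ⟩
  · rcases eq_or_ne x a with rfl | hx
    · exact .inr ⟨none, fun t => φ t, fun _ _ ht => hφ ht, by fun_prop, fun t =>
        (hγ t).trans (closeArc_coe _ ha.symm (φ t)).symm⟩
    · exact .inl ⟨⟨x, hx⟩, φ, hφ, hφ', hγ⟩
  · exact .inr ⟨some l, φ, hφ, hφ', hγ⟩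

theorem WeaklyEmbedded.gluesTo_close (h : S.WeaklyEmbedded) (ha : S.arc a 1 = S.arc a 0) :
    S.GluesTo (S.close a ha) := by
  refine gluesTo_of_glued_point (support_close ha) (.close ha) ⟨a, ha.symm⟩ ⟨a, rfl⟩ ?_ ?_ <;>
    refine Set.Subset.antisymm ?_ ?_
  · rintro _ ⟨x, rfl⟩
    exact ⟨⟨x, rfl⟩, h.arc_ne_of_closed ha x.2 _ _⟩
  · rintro _ ⟨⟨x, rfl⟩, hx⟩
    exact ⟨⟨x, fun e => hx (by subst e; exact ha.symm)⟩, rfl⟩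
  · rintro _ ⟨x, rfl⟩
    exact ⟨⟨x, rfl⟩, h.arc_ne_of_closed ha x.2 _ _⟩
  · rintro _ ⟨⟨x, rfl⟩, hx⟩
    exact ⟨⟨x, fun e => hx (by subst e; rfl)⟩, rfl⟩

end Close

section Concat

variable {S : Strands M A Λ} {a b : A}

open Classical in
/-- The interval `b`, which begins where the interval `a` ends, is appended to `a`. -/
noncomputable def concat (S : Strands M A Λ) (a b : A) (hglue : S.arc a 1 = S.arc b 0) :
    Strands M {x // x ≠ b} Λ where
  arc x := if x.1 = a then joinArc (S.arc a) (S.arc b) hglue else S.arc x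
  loop := S.loop

theorem concat_arc_self (hglue : S.arc a 1 = S.arc b 0) (hab : a ≠ b) :
    (S.concat a b hglue).arc ⟨a, hab⟩ = joinArc (S.arc a) (S.arc b) hglue := if_pos rfl

theorem concat_arc_of_ne (hglue : S.arc a 1 = S.arc b 0) {x : {x // x ≠ b}} (hx : x.1 ≠ a) :
    (S.concat a b hglue).arc x = S.arc x := if_neg hx

theorem concat_arc_zero (hglue : S.arc a 1 = S.arc b 0) (x : {x // x ≠ b}) :
    (S.concat a b hglue).arc x 0 = S.arc x 0 := by
  obtain ⟨x, hx⟩ := x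
  rcases eq_or_ne x a with rfl | hxa
  · rw [concat_arc_self hglue hx, joinArc_zero]
  · rw [concat_arc_of_ne hglue hxa]

theorem concat_arc_cases (hglue : S.arc a 1 = S.arc b 0) (x : {x // x ≠ b}) (t : I) :
    (∃ u, t = firstHalf u ∧ x.1 = a ∧ (S.concat a b hglue).arc x t = S.arc a u) ∨
      (∃ u, t = secondHalf u ∧ x.1 = a ∧ (S.concat a b hglue).arc x t = S.arc b u) ∨
      (x.1 ≠ a ∧ (S.concat a b hglue).arc x t = S.arc x t) := by
  obtain ⟨x, hx⟩ := x
  rcases eq_or_ne x a with rfl | hxa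
  · rw [concat_arc_self hglue hx]
    rcases eq_firstHalf_or_secondHalf t with ⟨u, rfl⟩ | ⟨u, rfl⟩
    · exact .inl ⟨u, rfl, rfl, joinArc_firstHalf ..⟩
    · exact .inr (.inl ⟨u, rfl, rfl, joinArc_secondHalf ..⟩)
  · exact .inr (.inr ⟨hxa, by rw [concat_arc_of_ne hglue hxa]⟩)

theorem WeaklyEmbedded.concat (h : S.WeaklyEmbedded) (hab : a ≠ b)
    (hglue : S.arc a 1 = S.arc b 0) : (S.concat a b hglue).WeaklyEmbedded where
  arc_eq {x t y t'} e := by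
    have := @h.arc_eq
    have := @h.start_injective
    have := @h.end_injective
    have := firstHalf_zero
    have := firstHalf_one
    have := secondHalf_one
    have := x.2
    have := y.2
    rcases concat_arc_cases hglue x t with ⟨u, rfl, hx, e₁⟩ | ⟨u, rfl, hx, e₁⟩ | ⟨hx, e₁⟩ <;>
      rcases concat_arc_cases hglue y t' with ⟨v, rfl, hy, e₂⟩ | ⟨v, rfl, hy, e₂⟩ | ⟨hy, e₂⟩ <;>
      rw [e₁, e₂] at e <;> grind
  arc_ne_loop x t l u e := by
    rcases concat_arc_cases hglue x t with ⟨v, -, -, e₁⟩ | ⟨v, -, -, e₁⟩ | ⟨-, e₁⟩ <;>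
      exact h.arc_ne_loop _ _ _ _ (e₁.symm.trans e)
  loop_eq := h.loop_eq

theorem support_concat (hab : a ≠ b) (hglue : S.arc a 1 = S.arc b 0) :
    (S.concat a b hglue).support = S.support := by
  ext z
  simp only [mem_support_iff]
  refine or_congr_left ⟨?_, ?_⟩
  · rintro ⟨x, t, rfl⟩
    rcases concat_arc_cases hglue x t with ⟨v, -, -, e⟩ | ⟨v, -, -, e⟩ | ⟨-, e⟩ <;>
      exact ⟨_, _, e.symm⟩
  · rintro ⟨x, t, rfl⟩
    rcases eq_or_ne x a with rfl | hxa
    · exact ⟨⟨x, hab⟩, firstHalf t, by rw [concat_arc_self, joinArc_firstHalf]⟩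
    rcases eq_or_ne x b with rfl | hxb
    · exact ⟨⟨a, hab⟩, secondHalf t, by rw [concat_arc_self, joinArc_secondHalf]⟩
    · exact ⟨⟨x, hxb⟩, t, by rw [concat_arc_of_ne hglue hxa]⟩

theorem IsPositivePath.concat (hab : a ≠ b) (hglue : S.arc a 1 = S.arc b 0) {γ : I → M}
    (hγ : S.IsPositivePath γ) : (S.concat a b hglue).IsPositivePath γ := by
  refine hγ.imp_left ?_
  rintro ⟨x, φ, hφ, hφ', hγ⟩
  rcases eq_or_ne x a with rfl | hxa
  · exact ⟨⟨x, hab⟩, firstHalf ∘ φ, strictMono_firstHalf.comp hφ, continuous_firstHalf.comp hφ',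
      fun t => by rw [concat_arc_self, hγ, Function.comp_apply, joinArc_firstHalf]⟩
  rcases eq_or_ne x b with rfl | hxb
  · exact ⟨⟨a, hab⟩, secondHalf ∘ φ, strictMono_secondHalf.comp hφ, continuous_secondHalf.comp hφ',
      fun t => by rw [concat_arc_self, hγ, Function.comp_apply, joinArc_secondHalf]⟩
  · exact ⟨⟨x, hxb⟩, φ, hφ, hφ', fun t => by rw [concat_arc_of_ne hglue hxa, hγ]⟩

theorem WeaklyEmbedded.starts_concat (h : S.WeaklyEmbedded) (hglue : S.arc a 1 = S.arc b 0) :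
    (S.concat a b hglue).starts = S.starts \ {S.arc a 1} := by
  refine Set.Subset.antisymm ?_ ?_
  · rintro _ ⟨x, rfl⟩
    simp only [concat_arc_zero]
    exact ⟨⟨x, rfl⟩, fun e => x.2 (h.start_injective (Eq.trans e hglue))⟩
  · rintro _ ⟨⟨x, rfl⟩, hx⟩
    exact ⟨⟨x, fun e => hx (by subst e; exact hglue.symm)⟩, concat_arc_zero hglue _⟩

theorem WeaklyEmbedded.ends_concat (h : S.WeaklyEmbedded) (hab : a ≠ b)
    (hglue : S.arc a 1 = S.arc b 0) : (S.concat a b hglue).ends = S.ends \ {S.arc a 1} := by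
  have arc_self_one : (S.concat a b hglue).arc ⟨a, hab⟩ 1 = S.arc b 1 := by
    rw [concat_arc_self hglue hab, joinArc_one]
  have arc_one {x : A} (hxa : x ≠ a) (hxb : x ≠ b) :
      (S.concat a b hglue).arc ⟨x, hxb⟩ 1 = S.arc x 1 :=
    DFunLike.congr_fun (concat_arc_of_ne hglue (x := ⟨x, hxb⟩) hxa) 1
  refine Set.Subset.antisymm ?_ ?_
  · rintro _ ⟨⟨x, hxb⟩, rfl⟩
    rcases eq_or_ne x a with rfl | hxa
    · simp only [arc_self_one]
      exact ⟨⟨b, rfl⟩, fun e => hxb (h.end_injective e).symm⟩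
    · simp only [arc_one hxa hxb]
      exact ⟨⟨x, rfl⟩, fun e => hxa (h.end_injective e)⟩
  · rintro _ ⟨⟨x, rfl⟩, hx⟩
    rcases eq_or_ne x b with rfl | hxb
    · exact ⟨⟨a, hab⟩, arc_self_one⟩
    · exact ⟨⟨x, hxb⟩, arc_one (fun e => hx (by subst e; rfl)) hxb⟩

theorem WeaklyEmbedded.gluesTo_concat (h : S.WeaklyEmbedded) (hab : a ≠ b)
    (hglue : S.arc a 1 = S.arc b 0) : S.GluesTo (S.concat a b hglue) :=
  gluesTo_of_glued_point (support_concat hab hglue) (.concat hab hglue) ⟨b, hglue.symm⟩ ⟨a, rfl⟩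
    (h.starts_concat hglue) (h.ends_concat hab hglue)

end Concat

section Embed

variable {S : Strands M A Λ}

theorem WeaklyEmbedded.embedded (h : S.WeaklyEmbedded) (hne : ∀ a b, S.arc a 1 ≠ S.arc b 0) :
    S.Embedded where
  arc_eq e := by
    rcases h.arc_eq e with e' | ⟨rfl, rfl⟩ | ⟨rfl, rfl⟩
    · exact e'
    · exact absurd e (hne _ _)
    · exact absurd e.symm (hne _ _)
  arc_ne_loop := h.arc_ne_loop
  loop_eq := h.loop_eq

theorem WeaklyEmbedded.exists_embedded {A : Type w} {Λ : Type u} [Finite A] [Finite Λ]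
    {S : Strands M A Λ} (h : S.WeaklyEmbedded) :
    ∃ (A' : Type w) (Λ' : Type u) (S' : Strands M A' Λ'),
      Finite Λ' ∧ S'.Embedded ∧ S.GluesTo S' := by
  induction hn : Nat.card A using Nat.strong_induction_on generalizing A Λ with
  | _ n ih =>
  have card_lt (c : A) : Nat.card {x // x ≠ c} < n := by
    rw [← hn]
    exact Finite.card_subtype_lt (x := c) (by simp)
  by_cases hglue : ∃ a b, S.arc a 1 = S.arc b 0
  · obtain ⟨a, b, hglue⟩ := hglue
    rcases eq_or_ne a b with rfl | hab
    · obtain ⟨A', Λ', S', hfin, hS', hglues⟩ := ih _ (card_lt a) (h.close hglue) rfl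
      exact ⟨A', Λ', S', hfin, hS', (h.gluesTo_close hglue).trans hglues⟩
    · obtain ⟨A', Λ', S', hfin, hS', hglues⟩ := ih _ (card_lt b) (h.concat hab hglue) rfl
      exact ⟨A', Λ', S', hfin, hS', (h.gluesTo_concat hab hglue).trans hglues⟩
  · push Not at hglue
    exact ⟨A, Λ, S, ‹_›, h.embedded hglue, rfl, _root_.id, rfl, rfl⟩

end Embed

end Strands

/-! ### Components of glued strands -/

section GlueComponents

variable {X Y G : Type} (q : X ⊕ G ≃ Y ⊕ G)

/-- The components of the union of intervals that `q` describes; each is represented by the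
beginning points of the intervals it consists of. -/
abbrev GlueComponent : Type := Quot (GlueStep q)

/-- The components of glued points, as they are counted by `glueCircles`. -/
abbrev GluedPointComponent : Type := Quot fun g g' : G => q (Sum.inr g) = Sum.inr g'

variable {q}

/-- The component contains no free ending point, so that it is a circle. -/
def GlueComponent.IsClosed (K : GlueComponent q) : Prop :=
  ∀ z, Quot.mk _ z = K → ∀ y, q z ≠ .inl y

/-- The component in which a component of glued points is contained. -/
def GluedPointComponent.toGlueComponent : GluedPointComponent q → GlueComponent q :=
  Quot.map Sum.inr fun _ g' h => ⟨g', h, rfl⟩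

theorem GlueComponent.mk_eq_mk {z z' : X ⊕ G} (h : Relation.ReflTransGen (GlueStep q) z z') :
    (Quot.mk _ z : GlueComponent q) = Quot.mk _ z' := by
  induction h with
  | refl => rfl
  | tail _ hstep ih => exact ih.trans (Quot.sound hstep)

variable (q) in
theorem exists_glueComponent_retraction : ∃ r : GlueComponent q → Option (GluedPointComponent q),
    (∀ g, r (Quot.mk _ (.inr g)) = some (Quot.mk _ g)) ∧
      ∀ x y, q (.inl x) = .inl y → r (Quot.mk _ (.inl x)) = none := by
  refine ⟨Quot.lift (Sum.elim
    (fun x => (q (.inl x)).elim (fun _ => none) fun g => some (Quot.mk _ g))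
    fun g => some (Quot.mk _ g)) ?_, fun _ => rfl, fun x y hx => ?_⟩
  · rintro (x | g) _ ⟨g', hg, rfl⟩
    · simp only [Sum.elim_inl, Sum.elim_inr, hg]
    · exact congrArg some (Quot.sound hg)
  · simp only [Sum.elim_inl, hx]

theorem GluedPointComponent.toGlueComponent_injective :
    Function.Injective (toGlueComponent (q := q)) := by
  obtain ⟨r, hr, -⟩ := exists_glueComponent_retraction q
  rintro ⟨g⟩ ⟨g'⟩ h
  exact Option.some_injective _ ((hr g).symm.trans ((congrArg r h).trans (hr g')))

theorem GluedPointComponent.isClosed_toGlueComponent {K : GluedPointComponent q} :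
    K.toGlueComponent.IsClosed ↔ ∀ g, Quot.mk _ g = K → ∀ y, q (.inr g) ≠ .inl y := by
  refine ⟨fun h g hg => h _ (by rw [← hg]; rfl), ?_⟩
  rintro h (x | g) hz y hy
  · obtain ⟨r, hr, hr'⟩ := exists_glueComponent_retraction q
    obtain ⟨g, rfl⟩ := Quot.mk_surjective K
    have none_eq_some := (hr' x y hy).symm.trans ((congrArg r hz).trans (hr g))
    cases none_eq_some
  · exact h g (toGlueComponent_injective hz) y hy

theorem glueCircles_eq_zero_of_isEmpty [IsEmpty G] : glueCircles q = 0 := by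
  have : IsEmpty (GluedPointComponent q) :=
    ⟨fun K => isEmptyElim (Quot.mk_surjective K).choose⟩
  exact Nat.card_of_isEmpty

variable [Finite G]

theorem GlueComponent.IsClosed.exists_gluedPointComponent {K : GlueComponent q} (hK : K.IsClosed) :
    ∃ K' : GluedPointComponent q, K'.toGlueComponent = K := by
  obtain ⟨x | g, rfl⟩ := Quot.mk_surjective K
  · obtain ⟨y, z, hxz, hy⟩ := glueLeads_exists q x
    have hz : Quot.mk (GlueStep q) z = Quot.mk _ (.inl x) :=
      (GlueComponent.mk_eq_mk hxz).symm
    exact absurd hy (hK z hz y)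
  · exact ⟨Quot.mk _ g, rfl⟩

theorem card_isClosed_glueComponent :
    Nat.card {K : GlueComponent q // K.IsClosed} = glueCircles q := by
  refine (Nat.card_congr (Equiv.ofBijective (fun K => ⟨GluedPointComponent.toGlueComponent K.1,
    GluedPointComponent.isClosed_toGlueComponent.mpr K.2⟩) ⟨fun K K' h => ?_, ?_⟩)).symm
  · exact Subtype.ext (GluedPointComponent.toGlueComponent_injective (congrArg Subtype.val h))
  · rintro ⟨K, hK⟩
    obtain ⟨K', rfl⟩ := hK.exists_gluedPointComponent
    exact ⟨⟨K', GluedPointComponent.isClosed_toGlueComponent.mp hK⟩, rfl⟩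

end GlueComponents

section Cover

variable {M ι κ : Type*} [TopologicalSpace M] [Finite ι] {C : ι → Set M}

theorem exists_subset_of_isPreconnected_of_finite_closed_cover {K : Set M} (hK : IsPreconnected K)
    (hne : K.Nonempty) (hC : ∀ i, IsClosed (C i)) (hdisj : ∀ {i j z}, z ∈ C i → z ∈ C j → i = j)
    (hcov : K ⊆ ⋃ i, C i) : ∃ i, K ⊆ C i := by
  obtain ⟨z, hz⟩ := hne
  obtain ⟨i, hi⟩ := Set.mem_iUnion.mp (hcov hz)
  let rest : Set M := ⋃ j : {j // j ≠ i}, C j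
  have notMem_rest {x} (hx : x ∈ C i) : x ∉ rest := fun hx' => by
    obtain ⟨j, hj⟩ := Set.mem_iUnion.mp hx'
    exact j.2 (hdisj hj hx)
  have cover : K ⊆ C i ∪ rest := fun x hx => by
    obtain ⟨j, hj⟩ := Set.mem_iUnion.mp (hcov hx)
    rcases eq_or_ne j i with rfl | hji
    · exact .inl hj
    · exact .inr (Set.mem_iUnion.mpr ⟨⟨j, hji⟩, hj⟩)
  have disjoint : K ∩ (C i ∩ rest) = ∅ :=
    Set.eq_empty_iff_forall_notMem.mpr fun x hx => notMem_rest hx.2.1 hx.2.2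
  have isClosed_rest : IsClosed rest := isClosed_iUnion_of_finite fun j => hC j
  exact ⟨i, (isPreconnected_iff_subset_of_disjoint_closed.mp hK _ _ (hC i) isClosed_rest cover
    disjoint).resolve_right fun h => notMem_rest hi (h hz)⟩

theorem exists_equiv_of_closed_cover_of_isPreconnected {D : κ → Set M}
    (hC : ∀ i, IsClosed (C i)) (hCne : ∀ i, (C i).Nonempty)
    (hCdisj : ∀ {i j z}, z ∈ C i → z ∈ C j → i = j)
    (hD : ∀ k, IsPreconnected (D k)) (hDne : ∀ k, (D k).Nonempty)
    (hDdisj : ∀ {k l z}, z ∈ D k → z ∈ D l → k = l)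
    (hsub : ∀ i, ∃ k, C i ⊆ D k) (hcov : ⋃ k, D k ⊆ ⋃ i, C i) :
    ∃ τ : ι ≃ κ, ∀ i, C i ⊆ D (τ i) := by
  choose τ hτ using hsub
  choose ρ hρ using fun k => exists_subset_of_isPreconnected_of_finite_closed_cover (hD k) (hDne k)
    hC hCdisj ((Set.subset_iUnion D k).trans hcov)
  refine ⟨⟨τ, ρ, fun i => ?_, fun k => ?_⟩, hτ⟩
  · obtain ⟨z, hz⟩ := hCne i
    exact hCdisj (hρ _ (hτ i hz)) hz
  · obtain ⟨z, hz⟩ := hDne k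
    exact hDdisj (hτ _ (hρ k hz)) hz

end Cover

namespace Strands

section Strand

variable {M : Type*} [TopologicalSpace M] {A Λ : Type*} {S : Strands M A Λ}

/-- The image of an interval or of a circle. -/
def strand (S : Strands M A Λ) (c : A ⊕ Λ) : Set M :=
  c.elim (fun a => Set.range (S.arc a)) fun l => Set.range (S.loop l)

theorem support_eq_iUnion_strand : S.support = ⋃ c, S.strand c := by
  rw [Set.iUnion_sum]
  rfl

theorem strand_nonempty (c : A ⊕ Λ) : (S.strand c).Nonempty := by
  rcases c with a | l <;> exact Set.range_nonempty _

theorem isPreconnected_strand (c : A ⊕ Λ) : IsPreconnected (S.strand c) := by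
  rcases c with a | l
  · exact isPreconnected_range (S.arc a).continuous
  · exact isPreconnected_range (S.loop l).continuous

theorem Embedded.strand_unique (h : S.Embedded) {c c' : A ⊕ Λ} {z : M} (hz : z ∈ S.strand c)
    (hz' : z ∈ S.strand c') : c = c' := by
  rcases c with a | l <;> rcases c' with a' | l' <;>
    obtain ⟨t, rfl⟩ := hz <;> obtain ⟨t', e⟩ := hz'
  · rw [(h.arc_eq e).1]
  · exact absurd e.symm (h.arc_ne_loop _ _ _ _)
  · exact absurd e (h.arc_ne_loop _ _ _ _)
  · rw [(h.loop_eq e).1]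

theorem IsPositivePath.exists_strand {γ : I → M} (h : S.IsPositivePath γ) :
    ∃ c, ∀ t, γ t ∈ S.strand c := by
  rcases h with ⟨a, φ, -, -, h⟩ | ⟨l, φ, -, -, h⟩
  · exact ⟨.inl a, fun t => ⟨φ t, (h t).symm⟩⟩
  · exact ⟨.inr l, fun t => ⟨_, (h t).symm⟩⟩

theorem Embedded.exists_lt_of_isPositivePath (h : S.Embedded) {γ : I → M} (hγ : S.IsPositivePath γ)
    {a : A} {t : I} (ht : γ t ∈ S.strand (.inl a)) :
    ∃ u v, u < v ∧ γ 0 = S.arc a u ∧ γ 1 = S.arc a v := by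
  obtain ⟨u, hu⟩ := ht
  rcases hγ with ⟨a', φ, hφ, -, hγ⟩ | ⟨l, φ, -, -, hγ⟩
  · rw [hγ] at hu
    obtain rfl := (h.arc_eq hu).1
    exact ⟨φ 0, φ 1, hφ zero_lt_one, hγ 0, hγ 1⟩
  · rw [hγ] at hu
    exact absurd hu (h.arc_ne_loop _ _ _ _)

end Strand

section GluesAlong

variable {M : Type*} [TopologicalSpace M] {A' Λ Λ' : Type*} {X Y G : Type}
  {S : Strands M (X ⊕ G) Λ} {q : X ⊕ G ≃ Y ⊕ G} {S' : Strands M A' Λ'}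

/-- The embedded strands `S'` result from `S` by gluing the intervals end to end as prescribed by
`q`. -/
structure GluesAlong (S : Strands M (X ⊕ G) Λ) (q : X ⊕ G ≃ Y ⊕ G) (S' : Strands M A' Λ') :
    Prop where
  weaklyEmbedded : S.WeaklyEmbedded
  embedded : S'.Embedded
  end_eq_start_iff : ∀ {z z'}, S.arc z 1 = S.arc z' 0 ↔ GlueStep q z z'
  isPositivePath : ∀ {γ}, S.IsPositivePath γ → S'.IsPositivePath γ
  support_eq : S'.support = S.support

/-- The union of the strands of `S` that belong to a component. -/
def component (S : Strands M (X ⊕ G) Λ) (q : X ⊕ G ≃ Y ⊕ G) (K : GlueComponent q ⊕ Λ) : Set M :=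
  K.elim (fun K => ⋃ z : {z // Quot.mk _ z = K}, Set.range (S.arc z)) fun l => Set.range (S.loop l)

theorem arc_mem_component (z : X ⊕ G) (t : I) :
    S.arc z t ∈ S.component q (.inl (Quot.mk _ z)) :=
  Set.mem_iUnion.mpr ⟨⟨z, rfl⟩, t, rfl⟩

theorem component_nonempty (K : GlueComponent q ⊕ Λ) : (S.component q K).Nonempty := by
  rcases K with K | l
  · obtain ⟨z, rfl⟩ := Quot.mk_surjective K
    exact ⟨_, arc_mem_component z 0⟩
  · exact Set.range_nonempty _

theorem isClosed_component [T2Space M] [Finite X] [Finite G] (K : GlueComponent q ⊕ Λ) :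
    IsClosed (S.component q K) := by
  rcases K with K | l
  · exact isClosed_iUnion_of_finite fun z => (isCompact_range (S.arc z).continuous).isClosed
  · exact (isCompact_range (S.loop l).continuous).isClosed

theorem support_eq_iUnion_component : S.support = ⋃ K, S.component q K := by
  ext z
  rw [mem_support_iff, Set.iUnion_sum]
  refine or_congr ⟨?_, fun h => ?_⟩
    (Set.mem_iUnion (s := fun l => Set.range (S.loop l))).symm
  · rintro ⟨z, t, rfl⟩
    exact Set.mem_iUnion.mpr ⟨_, arc_mem_component z t⟩
  · obtain ⟨K, hK⟩ := Set.mem_iUnion.mp h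
    obtain ⟨z, hz⟩ := Set.mem_iUnion.mp hK
    exact ⟨z, hz⟩

namespace GluesAlong

theorem component_unique (h : S.GluesAlong q S') {K K' : GlueComponent q ⊕ Λ} {z : M}
    (hz : z ∈ S.component q K) (hz' : z ∈ S.component q K') : K = K' := by
  have hS := h.weaklyEmbedded
  rcases K with K | l <;> rcases K' with K' | l'
  · obtain ⟨⟨w, rfl⟩, t, rfl⟩ := Set.mem_iUnion.mp hz
    obtain ⟨⟨w', rfl⟩, t', e⟩ := Set.mem_iUnion.mp hz'
    rcases hS.arc_eq e with ⟨rfl, -⟩ | ⟨rfl, rfl⟩ | ⟨rfl, rfl⟩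
    · rfl
    · rw [Quot.sound (h.end_eq_start_iff.mp e)]
    · rw [Quot.sound (h.end_eq_start_iff.mp e.symm)]
  · obtain ⟨w, t, rfl⟩ := Set.mem_iUnion.mp hz
    obtain ⟨u, e⟩ := hz'
    exact absurd e.symm (hS.arc_ne_loop _ _ _ _)
  · obtain ⟨w, t, rfl⟩ := Set.mem_iUnion.mp hz'
    obtain ⟨u, e⟩ := hz
    exact absurd e.symm (hS.arc_ne_loop _ _ _ _)
  · obtain ⟨u, rfl⟩ := hz
    obtain ⟨u', e⟩ := hz'
    rw [(hS.loop_eq e).1]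

theorem exists_component_subset_strand (h : S.GluesAlong q S') (K : GlueComponent q ⊕ Λ) :
    ∃ c, S.component q K ⊆ S'.strand c := by
  rcases K with K | l
  · obtain ⟨z, rfl⟩ := Quot.mk_surjective K
    choose κ hκ using fun z => (h.isPositivePath (S.isPositivePath_arc z)).exists_strand
    have κ_eq {z z'} (hzz' : GlueStep q z z') : κ z = κ z' := by
      have hz := hκ z 1
      rw [h.end_eq_start_iff.mpr hzz'] at hz
      exact h.embedded.strand_unique hz (hκ z' 0)
    refine ⟨κ z, Set.iUnion_subset ?_⟩
    rintro ⟨z', hz'⟩ _ ⟨t, rfl⟩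
    have hκz' : κ z' = κ z := congrArg (Quot.lift κ fun _ _ => κ_eq) hz'
    exact hκz' ▸ hκ z' t
  · obtain ⟨c, hc⟩ := (h.isPositivePath (S.isPositivePath_loop l)).exists_strand
    refine ⟨c, ?_⟩
    rintro _ ⟨u, rfl⟩
    obtain ⟨t, -, rfl⟩ := exists_unitInterval_coe_eq u
    exact hc t

theorem exists_equiv_component_subset_strand [T2Space M] [Finite X] [Finite G] [Finite Λ]
    (h : S.GluesAlong q S') :
    ∃ τ : GlueComponent q ⊕ Λ ≃ A' ⊕ Λ', ∀ K, S.component q K ⊆ S'.strand (τ K) :=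
  have : Finite (GlueComponent q) := Finite.of_surjective _ Quot.mk_surjective
  exists_equiv_of_closed_cover_of_isPreconnected isClosed_component component_nonempty
    h.component_unique isPreconnected_strand strand_nonempty h.embedded.strand_unique
    h.exists_component_subset_strand
    (by rw [← support_eq_iUnion_strand, h.support_eq, ← support_eq_iUnion_component])

/-- An ending point that is furthest along the interval `a` would have no successor. -/
theorem not_component_subset_strand_inl [Finite X] [Finite G] (h : S.GluesAlong q S')
    {K : GlueComponent q} (hK : K.IsClosed) {a : A'} :
    ¬ S.component q (.inl K) ⊆ S'.strand (.inl a) := fun hsub => by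
  have advances (z : {z // Quot.mk (GlueStep q) z = K}) :
      ∃ u v, u < v ∧ S.arc z 0 = S'.arc a u ∧ S.arc z 1 = S'.arc a v := by
    obtain ⟨z, rfl⟩ := z
    exact h.embedded.exists_lt_of_isPositivePath (h.isPositivePath (S.isPositivePath_arc z))
      (hsub (arc_mem_component z 0))
  choose u v huv hu hv using advances
  have : Nonempty {z // Quot.mk (GlueStep q) z = K} := ⟨_, (Quot.mk_surjective K).choose_spec⟩
  obtain ⟨z, hmax⟩ := Finite.exists_max u
  rcases hq : q z with y | g
  · exact hK _ z.2 y hq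
  · have step : GlueStep q z (.inr g) := ⟨g, hq, rfl⟩
    let next : {z // Quot.mk (GlueStep q) z = K} := ⟨.inr g, by rw [← Quot.sound step, z.2]⟩
    have hvu : v z = u next :=
      (h.embedded.arc_eq ((hv z).symm.trans ((h.end_eq_start_iff.mpr step).trans (hu next)))).2
    exact (hmax next).not_gt (hvu ▸ huv z)

theorem not_loop_subset_strand_inl (h : S.GluesAlong q S') {l : Λ} {a : A'} :
    ¬ S.component q (.inr l) ⊆ S'.strand (.inl a) := fun hsub => by
  obtain ⟨u, v, huv, hu, hv⟩ := h.embedded.exists_lt_of_isPositivePath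
    (h.isPositivePath (S.isPositivePath_loop l)) (t := 0) (hsub ⟨_, rfl⟩)
  simp only [Set.Icc.coe_zero, Set.Icc.coe_one] at hu hv
  rw [AddCircle.coe_period, ← AddCircle.coe_zero] at hv
  exact huv.ne (h.embedded.arc_eq (hu.symm.trans hv)).2

theorem card_loops [T2Space M] [Finite X] [Finite G] [Finite Λ] (h : S.GluesAlong q S')
    (hend : ∀ z y, q z = .inl y → S.arc z 1 ∈ S'.ends) :
    Nat.card Λ' = Nat.card Λ + glueCircles q := by
  obtain ⟨τ, hτ⟩ := h.exists_equiv_component_subset_strand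
  have isRight_iff (K : GlueComponent q ⊕ Λ) :
      Sum.elim GlueComponent.IsClosed (fun _ => True) K ↔ (τ K).isRight = true := by
    have hsub := hτ K
    rcases hc : τ K with a | l'
    · simp only [Sum.isRight_inl, Bool.false_eq_true, iff_false]
      rw [hc] at hsub
      rcases K with K | l
      · exact fun hK => h.not_component_subset_strand_inl hK hsub
      · exact absurd hsub h.not_loop_subset_strand_inl
    · simp only [Sum.isRight_inr, iff_true]
      rcases K with K | l
      · rintro z rfl y hy
        obtain ⟨a, ha⟩ := hend z y hy
        have hz := hsub (arc_mem_component z 1)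
        rw [hc, ← ha] at hz
        cases h.embedded.strand_unique (c := .inl a) ⟨1, rfl⟩ hz
      · trivial
  have : Finite (GlueComponent q) := Finite.of_surjective _ Quot.mk_surjective
  rw [← Nat.card_congr ((τ.subtypeEquiv isRight_iff).trans Equiv.sumIsRight),
    Nat.card_congr Equiv.subtypeSum, Nat.card_sum, add_comm]
  exact congrArg₂ _ (Nat.card_congr (Equiv.subtypeUnivEquiv fun _ => trivial))
    card_isClosed_glueComponent

theorem exists_strand_of_glueLeads (h : S.GluesAlong q S') {x : X} {y : Y}
    (hxy : GlueLeads q x y) :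
    ∃ z c, q z = .inl y ∧ S.arc (.inl x) 0 ∈ S'.strand c ∧ S.arc z 1 ∈ S'.strand c := by
  obtain ⟨z, hxz, hy⟩ := hxy
  obtain ⟨c, hc⟩ := h.exists_component_subset_strand (.inl (Quot.mk _ z))
  refine ⟨z, c, hy, hc ?_, hc (arc_mem_component z 1)⟩
  rw [← GlueComponent.mk_eq_mk hxz]
  exact arc_mem_component (.inl x) 0

end GluesAlong

end GluesAlong

end Strands

/-! ### Discs with holes -/

namespace HoledDisc

variable {ι κ : Type} (H : HoledDisc ι) (i : ι)

/-- The `i`-th hole together with its boundary circle. -/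
def closedHole : Set ℂ := Metric.closedBall (H.center i) ‖H.scale i‖

variable {i}

theorem norm_scale_pos : 0 < ‖H.scale i‖ := norm_pos_iff.mpr (H.scale_ne_zero i)

theorem dist_hole (w w' : ℂ) : dist (H.hole i w) (H.hole i w') = ‖H.scale i‖ * dist w w' := by
  rw [hole, hole, dist_add_left, dist_eq_norm, dist_eq_norm, ← norm_mul, mul_sub]

theorem hole_bijective : Function.Bijective (H.hole i) :=
  (AddGroup.addLeft_bijective _).comp (mulLeft_bijective₀ _ (H.scale_ne_zero i))

theorem continuous_hole : Continuous (H.hole i) := by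
  unfold hole; fun_prop

theorem image_hole_closedBall (c : ℂ) (r : ℝ) :
    H.hole i '' Metric.closedBall c r = Metric.closedBall (H.hole i c) (‖H.scale i‖ * r) := by
  ext z
  obtain ⟨w, rfl⟩ := (H.hole_bijective (i := i)).2 z
  rw [H.hole_bijective.1.mem_set_image, Metric.mem_closedBall, Metric.mem_closedBall, dist_hole,
    mul_le_mul_iff_right₀ H.norm_scale_pos]

variable (i) in
theorem closedHole_eq_image : H.closedHole i = H.hole i '' Metric.closedBall 0 1 := by
  rw [image_hole_closedBall, mul_one, closedHole, hole, mul_zero, add_zero]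

theorem hole_mem_closedHole_iff {w : ℂ} : H.hole i w ∈ H.closedHole i ↔ ‖w‖ ≤ 1 := by
  rw [closedHole_eq_image, H.hole_bijective.1.mem_set_image, mem_closedBall_zero_iff]

theorem norm_hole_lt {w : ℂ} (hw : ‖w‖ ≤ 1) : ‖H.hole i w‖ < 1 :=
  mem_ball_zero_iff.mp (H.hole_subset i (H.hole_mem_closedHole_iff.mpr hw))

theorem eq_of_hole_eq_hole {j : ι} {w w' : ℂ} (hw : ‖w‖ ≤ 1) (hw' : ‖w'‖ ≤ 1)
    (h : H.hole i w = H.hole j w') : i = j := by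
  by_contra hij
  exact Set.disjoint_left.mp (H.hole_disjoint hij) (H.hole_mem_closedHole_iff.mpr hw)
    (h ▸ H.hole_mem_closedHole_iff.mpr hw')

theorem mem_interior_iff {z : ℂ} : z ∈ H.interior ↔ ‖z‖ < 1 ∧ ∀ i, z ∉ H.closedHole i := by
  simp only [interior, closedHole, Set.mem_ofPred_eq, Metric.mem_closedBall, not_le]

theorem hole_notMem_interior {w : ℂ} (hw : ‖w‖ ≤ 1) : H.hole i w ∉ H.interior := fun h =>
  (H.mem_interior_iff.mp h).2 i (H.hole_mem_closedHole_iff.mpr hw)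

theorem ext_of_hole {H H' : HoledDisc ι} (h : ∀ i z, H.hole i z = H'.hole i z) : H = H' := by
  have hcenter : H.center = H'.center := funext fun i => by simpa [hole] using h i 0
  have hscale : H.scale = H'.scale := funext fun i => by simpa [hole, hcenter] using h i 1
  cases H
  cases H'
  cases hcenter
  cases hscale
  rfl

variable (i) (H' : HoledDisc κ)

/-- The disc with holes that results from placing the disc with holes `H'` into the `i`-th hole of
`H`. -/
def comp : HoledDisc ({j // j ≠ i} ⊕ κ) where
  center := Sum.elim (fun j => H.center j.1) fun m => H.hole i (H'.center m)
  scale := Sum.elim (fun j => H.scale j.1) fun m => H.scale i * H'.scale m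
  scale_ne_zero := by
    rintro (j | m)
    · exact H.scale_ne_zero _
    · exact mul_ne_zero (H.scale_ne_zero _) (H'.scale_ne_zero _)
  hole_subset := by
    rintro (j | m)
    · exact H.hole_subset _
    · rw [Sum.elim_inr, Sum.elim_inr, norm_mul, ← image_hole_closedBall]
      rintro _ ⟨w, hw, rfl⟩
      exact mem_ball_zero_iff.mpr (H.norm_hole_lt (mem_ball_zero_iff.mp (H'.hole_subset m hw)).le)
  hole_disjoint := by
    have subset_closedHole (m : κ) : Metric.closedBall (H.hole i (H'.center m))
        ‖H.scale i * H'.scale m‖ ⊆ H.closedHole i := by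
      rw [norm_mul, ← image_hole_closedBall, closedHole_eq_image]
      exact Set.image_mono ((H'.hole_subset m).trans Metric.ball_subset_closedBall)
    rintro (j | m) (j' | m') hne
    · exact H.hole_disjoint fun h => hne (congrArg _ (Subtype.ext h))
    · exact (H.hole_disjoint j.2).mono_right (subset_closedHole m')
    · exact (H.hole_disjoint j'.2.symm).mono_left (subset_closedHole m)
    · simp only [Sum.elim_inr, norm_mul, ← image_hole_closedBall]
      exact (Set.disjoint_image_iff H.hole_bijective.1).mpr
        (H'.hole_disjoint fun h => hne (congrArg _ h))

theorem comp_hole_inl (j : {j // j ≠ i}) (z : ℂ) :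
    (H.comp i H').hole (.inl j) z = H.hole j.1 z := rfl

theorem comp_hole_inr (m : κ) (z : ℂ) :
    (H.comp i H').hole (.inr m) z = H.hole i (H'.hole m z) := by
  simp only [hole, comp, Sum.elim_inr]
  ring

theorem comp_closedHole_inl (j : {j // j ≠ i}) :
    (H.comp i H').closedHole (.inl j) = H.closedHole j.1 := rfl

theorem comp_closedHole_inr (m : κ) :
    (H.comp i H').closedHole (.inr m) = H.hole i '' H'.closedHole m := by
  rw [closedHole, closedHole, image_hole_closedBall, ← norm_mul]
  rfl

variable {i}

theorem closedHole_subset_closedBall (m : κ) : H'.closedHole m ⊆ Metric.closedBall 0 1 :=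
  (H'.hole_subset m).trans Metric.ball_subset_closedBall

theorem interior_subset_comp {z : ℂ} (hz : z ∈ H.interior) : z ∈ (H.comp i H').interior := by
  rw [mem_interior_iff] at hz ⊢
  refine ⟨hz.1, ?_⟩
  rintro (j | m)
  · exact hz.2 _
  · rw [comp_closedHole_inr]
    refine fun h => hz.2 i ?_
    rw [closedHole_eq_image]
    exact Set.image_mono (H'.closedHole_subset_closedBall m) h

theorem hole_mem_interior_comp {w : ℂ} (hw : ‖w‖ ≤ 1) (hw' : ∀ m, w ∉ H'.closedHole m) :
    H.hole i w ∈ (H.comp i H').interior := by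
  refine (mem_interior_iff _).mpr ⟨H.norm_hole_lt hw, ?_⟩
  rintro (j | m)
  · rw [comp_closedHole_inl]
    exact Set.disjoint_right.mp (H.hole_disjoint j.2) (H.hole_mem_closedHole_iff.mpr hw)
  · rw [comp_closedHole_inr, H.hole_bijective.1.mem_set_image]
    exact hw' m

theorem hole_mem_interior_comp_of_mem_interior {w : ℂ} (hw : w ∈ H'.interior) :
    H.hole i w ∈ (H.comp i H').interior :=
  H.hole_mem_interior_comp H' hw.1.le (H'.mem_interior_iff.mp hw).2

theorem hole_mem_interior_comp_of_norm_eq_one {w : ℂ} (hw : ‖w‖ = 1) :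
    H.hole i w ∈ (H.comp i H').interior :=
  H.hole_mem_interior_comp H' hw.le fun m h =>
    (mem_ball_zero_iff.mp (H'.hole_subset m h)).ne hw

end HoledDisc

/-! ### Marked points -/

section Marks

variable {ι : Type} {s : ι → SignSeq} {s₀ : SignSeq}

variable (s s₀) in
/-- The marked points on all boundary circles. -/
abbrev BoundaryMark : Type := Fin s₀.len ⊕ Σ i, Fin (s i).len

/-- Whether strands begin (`1`) or end (`-1`) at a marked point. -/
def BoundaryMark.direction : BoundaryMark s s₀ → ℤˣ :=
  Sum.elim s₀.sign fun p => -(s p.1).sign p.2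

/-- The underlying marked point of one at which a strand begins. -/
def BeginMark.toBoundaryMark : BeginMark s s₀ → BoundaryMark s s₀ :=
  Sum.map Subtype.val (Sigma.map id fun _ => Subtype.val)

/-- The underlying marked point of one at which a strand ends. -/
def EndMark.toBoundaryMark : EndMark s s₀ → BoundaryMark s s₀ :=
  Sum.map Subtype.val (Sigma.map id fun _ => Subtype.val)

theorem BeginMark.toBoundaryMark_injective :
    Function.Injective (toBoundaryMark : BeginMark s s₀ → BoundaryMark s s₀) :=
  Subtype.val_injective.sumMap
    (Function.injective_id.sigma_map fun _ => Subtype.val_injective)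

theorem EndMark.toBoundaryMark_injective :
    Function.Injective (toBoundaryMark : EndMark s s₀ → BoundaryMark s s₀) :=
  Subtype.val_injective.sumMap
    (Function.injective_id.sigma_map fun _ => Subtype.val_injective)

theorem BeginMark.direction_toBoundaryMark (b : BeginMark s s₀) :
    (toBoundaryMark b).direction = 1 := by
  rcases b with j | ⟨i, j⟩
  · exact j.2
  · exact neg_eq_iff_eq_neg.mpr j.2

theorem EndMark.direction_toBoundaryMark (e : EndMark s s₀) :
    (toBoundaryMark e).direction = -1 := by
  rcases e with j | ⟨i, j⟩
  · exact j.2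
  · exact congrArg Neg.neg j.2

namespace HoledDisc

variable (H : HoledDisc ι)

/-- The position of a marked point. -/
noncomputable def boundaryPoint : BoundaryMark s s₀ → ℂ :=
  Sum.elim markedPoint fun p => H.hole p.1 (markedPoint p.2)

theorem boundaryPoint_notMem_interior (m : BoundaryMark s s₀) :
    H.boundaryPoint m ∉ H.interior := by
  rcases m with j | ⟨i, j⟩
  · exact fun h => h.1.ne (norm_markedPoint j)
  · exact H.hole_notMem_interior (norm_markedPoint j).le

theorem norm_boundaryPoint_le (m : BoundaryMark s s₀) : ‖H.boundaryPoint m‖ ≤ 1 := by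
  rcases m with j | ⟨i, j⟩
  · exact (norm_markedPoint j).le
  · exact (H.norm_hole_lt (norm_markedPoint j).le).le

theorem exists_of_boundaryPoint_eq_hole {m : BoundaryMark s s₀} {i : ι} {w : ℂ} (hw : ‖w‖ ≤ 1)
    (h : H.boundaryPoint m = H.hole i w) : ∃ j, m = .inr ⟨i, j⟩ ∧ w = markedPoint j := by
  rcases m with j | ⟨i', j⟩
  · exact absurd ((congrArg norm h).symm.trans (norm_markedPoint j)) (H.norm_hole_lt hw).ne
  · obtain rfl := H.eq_of_hole_eq_hole (norm_markedPoint j).le hw h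
    exact ⟨j, rfl, (H.hole_bijective.1 h).symm⟩

theorem boundaryPoint_injective :
    Function.Injective (H.boundaryPoint : BoundaryMark s s₀ → ℂ) := by
  intro m m' h
  rcases m' with j' | ⟨i, j'⟩
  · rcases m with j | ⟨i, j⟩
    · exact congrArg _ (markedPoint_injective h)
    · exact absurd ((congrArg norm h).trans (norm_markedPoint j'))
        (H.norm_hole_lt (norm_markedPoint j).le).ne
  · obtain ⟨j, rfl, hj⟩ := H.exists_of_boundaryPoint_eq_hole (norm_markedPoint j').le h
    rw [markedPoint_injective hj]

theorem beginPoint_eq_boundaryPoint (b : BeginMark s s₀) :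
    H.beginPoint s s₀ b = H.boundaryPoint (BeginMark.toBoundaryMark b) := by
  rcases b with j | ⟨i, j⟩ <;> rfl

theorem endPoint_eq_boundaryPoint (e : EndMark s s₀) :
    H.endPoint s s₀ e = H.boundaryPoint (EndMark.toBoundaryMark e) := by
  rcases e with j | ⟨i, j⟩ <;> rfl

theorem beginPoint_injective : Function.Injective (H.beginPoint s s₀) := by
  rw [funext H.beginPoint_eq_boundaryPoint]
  exact H.boundaryPoint_injective.comp BeginMark.toBoundaryMark_injective

theorem endPoint_injective : Function.Injective (H.endPoint s s₀) := by
  rw [funext H.endPoint_eq_boundaryPoint]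
  exact H.boundaryPoint_injective.comp EndMark.toBoundaryMark_injective

theorem beginPoint_ne_endPoint (b : BeginMark s s₀) (e : EndMark s s₀) :
    H.beginPoint s s₀ b ≠ H.endPoint s s₀ e := by
  rw [beginPoint_eq_boundaryPoint, endPoint_eq_boundaryPoint, H.boundaryPoint_injective.ne_iff]
  intro h
  have := (BeginMark.direction_toBoundaryMark b).symm.trans
    ((congrArg _ h).trans (EndMark.direction_toBoundaryMark e))
  exact absurd this (by decide)

theorem beginPoint_notMem_interior (b : BeginMark s s₀) : H.beginPoint s s₀ b ∉ H.interior :=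
  H.beginPoint_eq_boundaryPoint b ▸ H.boundaryPoint_notMem_interior _

theorem endPoint_notMem_interior (e : EndMark s s₀) : H.endPoint s s₀ e ∉ H.interior :=
  H.endPoint_eq_boundaryPoint e ▸ H.boundaryPoint_notMem_interior _

end HoledDisc

end Marks

/-! ### Operations on strands -/

namespace Strands

section Operations

variable {M N : Type*} [TopologicalSpace M] [TopologicalSpace N] {A Λ A' Λ' : Type*}

/-- The images of the strands under a continuous map. -/
def map (S : Strands M A Λ) (f : C(M, N)) : Strands N A Λ :=
  ⟨fun a => f.comp (S.arc a), fun l => f.comp (S.loop l)⟩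

/-- The strands of two families together. -/
def sum (S : Strands M A Λ) (S' : Strands M A' Λ') : Strands M (A ⊕ A') (Λ ⊕ Λ') :=
  ⟨Sum.elim S.arc S'.arc, Sum.elim S.loop S'.loop⟩

/-- The same strands, with the intervals and the circles indexed differently. -/
def reindex (S : Strands M A Λ) (e : A' ≃ A) (f : Λ' ≃ Λ) : Strands M A' Λ' :=
  ⟨S.arc ∘ e, S.loop ∘ f⟩

variable {S : Strands M A Λ}

theorem mem_support_iff_exists_isPositivePath {z : M} :
    z ∈ S.support ↔ ∃ γ t, S.IsPositivePath γ ∧ γ t = z := by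
  rw [mem_support_iff]
  constructor
  · rintro (⟨a, t, rfl⟩ | ⟨l, u, rfl⟩)
    · exact ⟨_, t, S.isPositivePath_arc a, rfl⟩
    · obtain ⟨t, -, rfl⟩ := exists_unitInterval_coe_eq u
      exact ⟨_, t, S.isPositivePath_loop l, rfl⟩
  · rintro ⟨γ, t, ⟨a, φ, -, -, h⟩ | ⟨l, φ, -, -, h⟩, rfl⟩
    · exact .inl ⟨a, _, (h t).symm⟩
    · exact .inr ⟨l, _, (h t).symm⟩

theorem Embedded.disjoint_starts_ends (h : S.Embedded) : Disjoint S.starts S.ends := by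
  rw [Set.disjoint_left]
  rintro _ ⟨a, rfl⟩ ⟨b, hb⟩
  exact one_ne_zero (h.arc_eq hb).2

theorem Embedded.starts_diff_ends (h : S.Embedded) : S.starts \ S.ends = S.starts :=
  sdiff_eq_left.mpr h.disjoint_starts_ends

theorem Embedded.ends_diff_starts (h : S.Embedded) : S.ends \ S.starts = S.ends :=
  sdiff_eq_left.mpr h.disjoint_starts_ends.symm

theorem Embedded.map (h : S.Embedded) {f : C(M, N)} (hf : Function.Injective f) :
    (S.map f).Embedded :=
  ⟨fun e => h.arc_eq (hf e), fun _ _ _ _ e => h.arc_ne_loop _ _ _ _ (hf e),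
    fun e => h.loop_eq (hf e)⟩

theorem support_map {f : C(M, N)} : (S.map f).support = f '' S.support := by
  simp only [support, map, Set.image_union, Set.image_iUnion, ContinuousMap.coe_comp,
    Set.range_comp]

theorem isPositivePath_map {f : C(M, N)} {γ : I → N} :
    (S.map f).IsPositivePath γ ↔ ∃ γ', S.IsPositivePath γ' ∧ γ = f ∘ γ' := by
  constructor
  · rintro (⟨a, φ, hmono, hcont, hγ⟩ | ⟨l, φ, hmono, hcont, hγ⟩)
    · exact ⟨_, .inl ⟨a, φ, hmono, hcont, fun _ => rfl⟩, funext hγ⟩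
    · exact ⟨_, .inr ⟨l, φ, hmono, hcont, fun _ => rfl⟩, funext hγ⟩
  · rintro ⟨γ', ⟨a, φ, hmono, hcont, hγ⟩ | ⟨l, φ, hmono, hcont, hγ⟩, rfl⟩
    · exact .inl ⟨a, φ, hmono, hcont, fun t => congrArg f (hγ t)⟩
    · exact .inr ⟨l, φ, hmono, hcont, fun t => congrArg f (hγ t)⟩

theorem WeaklyEmbedded.sum {S' : Strands M A' Λ'} (h : S.WeaklyEmbedded) (h' : S'.WeaklyEmbedded)
    (arc_eq_arc : ∀ a t a' t', S.arc a t = S'.arc a' t' → (t = 1 ∧ t' = 0) ∨ t = 0 ∧ t' = 1)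
    (loop_notMem : ∀ l u, S.loop l u ∉ S'.support)
    (loop_notMem' : ∀ l u, S'.loop l u ∉ S.support) : (S.sum S').WeaklyEmbedded where
  arc_eq := by
    rintro (a | a) t (a' | a') t' e
    · exact (h.arc_eq e).imp_left fun h => ⟨congrArg _ h.1, h.2⟩
    · exact .inr (arc_eq_arc _ _ _ _ e)
    · exact .inr ((arc_eq_arc _ _ _ _ e.symm).symm.imp And.symm And.symm)
    · exact (h'.arc_eq e).imp_left fun h => ⟨congrArg _ h.1, h.2⟩
  arc_ne_loop := by
    rintro (a | a) t (l | l) u e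
    · exact h.arc_ne_loop _ _ _ _ e
    · exact loop_notMem' l u (mem_support_iff.mpr (.inl ⟨a, t, e⟩))
    · exact loop_notMem l u (mem_support_iff.mpr (.inl ⟨a, t, e⟩))
    · exact h'.arc_ne_loop _ _ _ _ e
  loop_eq := by
    rintro (l | l) u (l' | l') u' e
    · exact ⟨congrArg _ (h.loop_eq e).1, (h.loop_eq e).2⟩
    · exact absurd (mem_support_iff.mpr (.inr ⟨l', u', e.symm⟩)) (loop_notMem l u)
    · exact absurd (mem_support_iff.mpr (.inr ⟨l', u', e.symm⟩)) (loop_notMem' l u)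
    · exact ⟨congrArg _ (h'.loop_eq e).1, (h'.loop_eq e).2⟩

theorem support_sum {S' : Strands M A' Λ'} : (S.sum S').support = S.support ∪ S'.support := by
  simp only [support, sum, Set.iUnion_sum, Sum.elim_inl, Sum.elim_inr]
  exact Set.union_union_union_comm _ _ _ _

theorem isPositivePath_sum {S' : Strands M A' Λ'} {γ : I → M} :
    (S.sum S').IsPositivePath γ ↔ S.IsPositivePath γ ∨ S'.IsPositivePath γ := by
  simp only [IsPositivePath, Sum.exists, sum, Sum.elim_inl, Sum.elim_inr]
  exact or_or_or_comm

variable {e : A' ≃ A} {f : Λ' ≃ Λ}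

theorem WeaklyEmbedded.reindex (h : S.WeaklyEmbedded) : (S.reindex e f).WeaklyEmbedded where
  arc_eq h' := (h.arc_eq h').imp_left fun h' => ⟨e.injective h'.1, h'.2⟩
  arc_ne_loop _ _ _ := h.arc_ne_loop _ _ _
  loop_eq h' := ⟨f.injective (h.loop_eq h').1, (h.loop_eq h').2⟩

theorem support_reindex : (S.reindex e f).support = S.support :=
  congrArg₂ _ (e.surjective.iUnion_comp fun a => Set.range (S.arc a))
    (f.surjective.iUnion_comp fun l => Set.range (S.loop l))

theorem isPositivePath_reindex {γ : I → M} :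
    (S.reindex e f).IsPositivePath γ ↔ S.IsPositivePath γ := by
  rw [IsPositivePath, IsPositivePath, e.surjective.exists, f.surjective.exists]
  rfl

end Operations

section Endpoints

variable {M : Type*} [TopologicalSpace M] {Λ : Type*} {X Y G : Type}

/-- The intervals described by `q` begin at the points `x` and `p` and end at the points `y` and
`p`, and only points indexed by the same element of `G` coincide. -/
structure HasEndpoints (S : Strands M (X ⊕ G) Λ) (q : X ⊕ G ≃ Y ⊕ G) (x : X → M) (y : Y → M)
    (p : G → M) : Prop where
  arc_zero : ∀ z, S.arc z 0 = Sum.elim x p z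
  arc_one : ∀ z, S.arc z 1 = Sum.elim y p (q z)
  start_ne_end : ∀ a b, x a ≠ y b
  glued_ne_start : ∀ g a, p g ≠ x a
  glued_ne_end : ∀ g b, p g ≠ y b
  glued_injective : Function.Injective p

namespace HasEndpoints

variable {S : Strands M (X ⊕ G) Λ} {q : X ⊕ G ≃ Y ⊕ G} {x : X → M} {y : Y → M} {p : G → M}

theorem end_eq_start_iff (h : S.HasEndpoints q x y p) {z z' : X ⊕ G} :
    S.arc z 1 = S.arc z' 0 ↔ GlueStep q z z' := by
  rw [h.arc_one, h.arc_zero]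
  constructor
  · intro e
    rcases hq : q z with b | g <;> rw [hq] at e <;> rcases z' with a | g'
    · exact absurd e.symm (h.start_ne_end a b)
    · exact absurd e.symm (h.glued_ne_end g' b)
    · exact absurd e (h.glued_ne_start g a)
    · exact ⟨g, hq, congrArg _ (h.glued_injective e).symm⟩
  · rintro ⟨g, hg, rfl⟩
    rw [hg, Sum.elim_inr, Sum.elim_inr]

theorem starts_eq (h : S.HasEndpoints q x y p) : S.starts = Set.range x ∪ Set.range p := by
  rw [starts, funext h.arc_zero, Set.Sum.elim_range]

theorem ends_eq (h : S.HasEndpoints q x y p) : S.ends = Set.range y ∪ Set.range p := by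
  rw [ends, funext h.arc_one, ← Set.Sum.elim_range]
  exact q.surjective.range_comp (Sum.elim y p)

theorem starts_diff_ends (h : S.HasEndpoints q x y p) : S.starts \ S.ends = Set.range x := by
  rw [h.starts_eq, h.ends_eq, Set.union_sdiff_distrib,
    Set.sdiff_eq_empty.mpr Set.subset_union_right, Set.union_empty, sdiff_eq_left,
    Set.disjoint_left]
  rintro _ ⟨a, rfl⟩ (⟨b, hb⟩ | ⟨g, hg⟩)
  · exact h.start_ne_end a b hb.symm
  · exact h.glued_ne_start g a hg

theorem ends_diff_starts (h : S.HasEndpoints q x y p) : S.ends \ S.starts = Set.range y := by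
  rw [h.starts_eq, h.ends_eq, Set.union_sdiff_distrib,
    Set.sdiff_eq_empty.mpr Set.subset_union_right, Set.union_empty, sdiff_eq_left,
    Set.disjoint_left]
  rintro _ ⟨b, rfl⟩ (⟨a, ha⟩ | ⟨g, hg⟩)
  · exact h.start_ne_end a b ha
  · exact h.glued_ne_end g b hg

end HasEndpoints

end Endpoints

end Strands

/-! ### The strands of a planar tangle -/

section TangleStrands

theorem exists_equiv_of_range_eq {A B M : Type*} {u : A → M} {v : B → M}
    (hu : Function.Injective u) (hv : Function.Injective v) (h : Set.range u = Set.range v) :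
    ∃ e : A ≃ B, ∀ a, v (e a) = u a :=
  ⟨(Equiv.ofInjective u hu).trans ((Equiv.setCongr h).trans (Equiv.ofInjective v hv).symm),
    fun _ => Equiv.apply_ofInjective_symm hv _⟩

variable {ι κ : Type} {s : ι → SignSeq} {s₀ : SignSeq}

namespace PlanarTangle

variable (T : PlanarTangle s s₀)

/-- The intervals and circles of a tangle. -/
def strands : Strands ℂ (BeginMark s s₀) (Fin T.circles) := ⟨T.arc, T.loop⟩

theorem strands_embedded : T.strands.Embedded where
  arc_eq {a t a' t'} e :=
    Prod.mk.inj (Sum.inl_injective (@T.injective (.inl (a, t)) (.inl (a', t')) e))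
  arc_ne_loop a t l u e := Sum.inl_ne_inr (@T.injective (.inl (a, t)) (.inr (l, u)) e)
  loop_eq {l u l' u'} e :=
    Prod.mk.inj (Sum.inr_injective (@T.injective (.inr (l, u)) (.inr (l', u')) e))

variable {T}

theorem eq_zero_or_one_of_arc_notMem_interior {b : BeginMark s s₀} {t : I}
    (h : T.arc b t ∉ T.interior) : t = 0 ∨ t = 1 := by
  by_contra! ht
  exact h (T.arc_mem b t ht.1 ht.2)

theorem arc_eq_boundaryPoint {b : BeginMark s s₀} {t : I} {m : BoundaryMark s s₀}
    (h : T.arc b t = T.boundaryPoint m) :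
    (t = 0 ∧ m.direction = 1) ∨ (t = 1 ∧ m.direction = -1) := by
  have ht : T.arc b t ∉ T.interior := h ▸ T.boundaryPoint_notMem_interior m
  rcases eq_zero_or_one_of_arc_notMem_interior ht with rfl | rfl
  · rw [T.arc_zero, T.beginPoint_eq_boundaryPoint] at h
    rw [← T.boundaryPoint_injective h]
    exact .inl ⟨rfl, BeginMark.direction_toBoundaryMark b⟩
  · rw [T.arc_one, T.endPoint_eq_boundaryPoint] at h
    rw [← T.boundaryPoint_injective h]
    exact .inr ⟨rfl, EndMark.direction_toBoundaryMark _⟩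

theorem mem_interior_or_eq_boundaryPoint {z : ℂ} (hz : z ∈ T.support) :
    z ∈ T.interior ∨ ∃ m : BoundaryMark s s₀, z = T.boundaryPoint m := by
  rcases T.strands.mem_support_iff.mp hz with ⟨b, t, rfl⟩ | ⟨l, u, rfl⟩
  · by_cases ht : T.arc b t ∈ T.interior
    · exact .inl ht
    · rcases eq_zero_or_one_of_arc_notMem_interior ht with rfl | rfl
      · exact .inr ⟨_, (T.arc_zero b).trans (T.beginPoint_eq_boundaryPoint b)⟩
      · exact .inr ⟨_, (T.arc_one b).trans (T.endPoint_eq_boundaryPoint _)⟩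
  · exact .inl (T.loop_mem l u)

theorem norm_le_of_mem_support {z : ℂ} (hz : z ∈ T.support) : ‖z‖ ≤ 1 := by
  rcases mem_interior_or_eq_boundaryPoint hz with h | ⟨m, rfl⟩
  · exact h.1.le
  · exact T.norm_boundaryPoint_le m

theorem exists_of_hole_mem_support {i : ι} {w : ℂ} (hw : ‖w‖ ≤ 1) (h : T.hole i w ∈ T.support) :
    ∃ j : Fin (s i).len, w = markedPoint j ∧
      T.hole i w = T.boundaryPoint (.inr ⟨i, j⟩ : BoundaryMark s s₀) := by
  obtain h | ⟨m, hm⟩ := mem_interior_or_eq_boundaryPoint h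
  · exact absurd h (T.hole_notMem_interior hw)
  · obtain ⟨j, rfl, hj⟩ := T.exists_of_boundaryPoint_eq_hole hw hm.symm
    exact ⟨j, hj, hm⟩

theorem matching_eq_of_mem_strand {c : BeginMark s s₀ ⊕ Fin T.circles} {b : BeginMark s s₀}
    {e : EndMark s s₀} (hb : T.beginPoint s s₀ b ∈ T.strands.strand c)
    (he : T.endPoint s s₀ e ∈ T.strands.strand c) : T.matching b = e := by
  have hb' : T.beginPoint s s₀ b ∈ T.strands.strand (.inl b) := ⟨0, T.arc_zero b⟩
  have he' : T.endPoint s s₀ e ∈ T.strands.strand (.inl (T.matching.symm e)) :=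
    ⟨1, (T.arc_one _).trans (congrArg _ (T.matching.apply_symm_apply e))⟩
  have hbe := (T.strands_embedded.strand_unique hb' hb).trans
    (T.strands_embedded.strand_unique he he')
  exact T.matching.eq_symm_apply.mp (Sum.inl_injective hbe)

theorem exists_of_embedded (H : HoledDisc ι) {A Λ : Type} [Finite Λ] {S : Strands ℂ A Λ}
    (hS : S.Embedded) (starts_eq : S.starts = Set.range (H.beginPoint s s₀))
    (ends_eq : S.ends = Set.range (H.endPoint s s₀))
    (support_subset : S.support ⊆ H.interior ∪ (S.starts ∪ S.ends)) :
    ∃ (T : PlanarTangle s s₀) (e : BeginMark s s₀ ≃ A) (f : Fin T.circles ≃ Λ),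
      T.toHoledDisc = H ∧ T.strands = S.reindex e f := by
  obtain ⟨e, he⟩ := exists_equiv_of_range_eq H.beginPoint_injective
    (fun _ _ h => (hS.arc_eq h).1) starts_eq.symm
  obtain ⟨e', he'⟩ := exists_equiv_of_range_eq H.endPoint_injective
    (fun _ _ h => (hS.arc_eq h).1) ends_eq.symm
  obtain ⟨n, ⟨f⟩⟩ := Finite.exists_equiv_fin Λ
  exact ⟨{
    toHoledDisc := H
    matching := e.trans e'.symm
    arc := S.arc ∘ e
    circles := n
    loop := S.loop ∘ f.symm
    arc_zero := he
    arc_one b := by rw [← he', Equiv.trans_apply, Equiv.apply_symm_apply, Function.comp_apply]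
    arc_mem b t h0 h1 := by
      rcases support_subset (Strands.mem_support_iff.mpr (.inl ⟨e b, t, rfl⟩)) with
        h | ⟨a, h⟩ | ⟨a, h⟩
      · exact h
      · exact absurd (hS.arc_eq h).2.symm h0
      · exact absurd (hS.arc_eq h).2.symm h1
    loop_mem l u := by
      rcases support_subset (Strands.mem_support_iff.mpr (.inr ⟨f.symm l, u, rfl⟩)) with
        h | ⟨a, h⟩ | ⟨a, h⟩
      · exact h
      · exact absurd h (hS.arc_ne_loop _ _ _ _)
      · exact absurd h (hS.arc_ne_loop _ _ _ _)
    injective := by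
      rintro (⟨b, t⟩ | ⟨l, u⟩) (⟨b', t'⟩ | ⟨l', u'⟩) h
      · exact congrArg Sum.inl (Prod.ext (e.injective (hS.arc_eq h).1) (hS.arc_eq h).2)
      · exact absurd h (hS.arc_ne_loop _ _ _ _)
      · exact absurd h.symm (hS.arc_ne_loop _ _ _ _)
      · exact congrArg Sum.inr (Prod.ext (f.symm.injective (hS.loop_eq h).1) (hS.loop_eq h).2) },
    e, f.symm, rfl, rfl⟩

end PlanarTangle

end TangleStrands

/-! ### Gluing a tangle into a hole of another -/

section GluedMarks

variable {ι κ : Type}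

/-- The marked points along which tangles are glued: those at which strands of the outer tangle
begin, and those at which they end. -/
abbrev GluedMark (a : SignSeq) : Type :=
  {j : Fin a.len // a.sign j = -1} ⊕ {j : Fin a.len // a.sign j = 1}

/-- The number of a glued marked point on its circle. -/
def GluedMark.index {a : SignSeq} : GluedMark a → Fin a.len := Sum.elim Subtype.val Subtype.val

theorem GluedMark.index_injective {a : SignSeq} :
    Function.Injective (index : GluedMark a → Fin a.len) :=
  Subtype.val_injective.sumElim Subtype.val_injective fun j j' h =>
    absurd (j.2.symm.trans ((congrArg a.sign h).trans j'.2)) (by decide)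

variable (s : ι → SignSeq) (s₀ : SignSeq) (i : ι) (s' : κ → SignSeq)

/-- The inputs of a composite. -/
abbrev compInputs : {j // j ≠ i} ⊕ κ → SignSeq := Sum.elim (fun j => s j.1) s'

/-- The points at which the strands of two tangles begin are those at which the strands of the
composite begin together with the glued points. -/
noncomputable def splitBegin :
    BeginMark (compInputs s i s') s₀ ⊕ GluedMark (s i) ≃ BeginMark s s₀ ⊕ BeginMark s' (s i) :=
  splitEquiv (fun a : SignSeq => {j : Fin a.len // a.sign j = -1})
    {j : Fin s₀.len // s₀.sign j = 1} {j : Fin (s i).len // (s i).sign j = 1} s i s'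

/-- The points at which the strands of two tangles end are those at which the strands of the
composite end together with the glued points. -/
noncomputable def splitEnd :
    EndMark (compInputs s i s') s₀ ⊕ GluedMark (s i) ≃ EndMark s s₀ ⊕ EndMark s' (s i) :=
  ((Equiv.refl _).sumCongr (Equiv.sumComm _ _)).trans
    (splitEquiv (fun a : SignSeq => {j : Fin a.len // a.sign j = 1})
      {j : Fin s₀.len // s₀.sign j = -1} {j : Fin (s i).len // (s i).sign j = -1} s i s')

end GluedMarks

namespace HoledDisc

variable {ι κ : Type} (H : HoledDisc ι) (i : ι) (H' : HoledDisc κ)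
  {s : ι → SignSeq} {s₀ : SignSeq} {s' : κ → SignSeq}

/-- The similarity `HoledDisc.hole` as a continuous map. -/
noncomputable def holeMap : C(ℂ, ℂ) := ⟨H.hole i, H.continuous_hole⟩

/-- The position of a glued marked point. -/
noncomputable def gluedPoint (g : GluedMark (s i)) : ℂ := H.hole i (markedPoint g.index)

theorem gluedPoint_injective : Function.Injective (H.gluedPoint (s := s) i) :=
  H.hole_bijective.1.comp (markedPoint_injective.comp GluedMark.index_injective)

theorem gluedPoint_mem_interior_comp (g : GluedMark (s i)) :
    H.gluedPoint i g ∈ (H.comp i H').interior :=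
  H.hole_mem_interior_comp_of_norm_eq_one H' (norm_markedPoint _)

theorem elim_beginPoint_splitBegin (z) :
    Sum.elim (H.beginPoint s s₀) (H.hole i ∘ H'.beginPoint s' (s i)) (splitBegin s s₀ i s' z) =
      Sum.elim ((H.comp i H').beginPoint (compInputs s i s') s₀) (H.gluedPoint i) z := by
  rcases z with (j | ⟨l | m, j⟩) | (j | j)
  · rfl
  · rfl
  · exact (H.comp_hole_inr i H' m _).symm
  · rfl
  · rfl

theorem elim_endPoint_splitEnd (z) :
    Sum.elim (H.endPoint s s₀) (H.hole i ∘ H'.endPoint s' (s i)) (splitEnd s s₀ i s' z) =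
      Sum.elim ((H.comp i H').endPoint (compInputs s i s') s₀) (H.gluedPoint i) z := by
  rcases z with (j | ⟨l | m, j⟩) | (j | j)
  · rfl
  · rfl
  · exact (H.comp_hole_inr i H' m _).symm
  · rfl
  · rfl

end HoledDisc

namespace PlanarTangle

variable {ι κ : Type} {s : ι → SignSeq} {s₀ : SignSeq} (T : PlanarTangle s s₀) (i : ι)
  {s' : κ → SignSeq} (T' : PlanarTangle s' (s i))

/-- The strands of `T` and of `T'`, placed into the `i`-th hole of `T`. -/
noncomputable def pieces :
    Strands ℂ (BeginMark (compInputs s i s') s₀ ⊕ GluedMark (s i))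
      (Fin T.circles ⊕ Fin T'.circles) :=
  (T.strands.sum (T'.strands.map (T.holeMap i))).reindex (splitBegin s s₀ i s') (Equiv.refl _)

/-- The gluing of the intervals of `T'` to those of `T`. -/
noncomputable def markGluing :
    BeginMark (compInputs s i s') s₀ ⊕ GluedMark (s i) ≃
      EndMark (compInputs s i s') s₀ ⊕ GluedMark (s i) :=
  (splitBegin s s₀ i s').trans ((T.matching.sumCongr T'.matching).trans (splitEnd s s₀ i s').symm)

theorem arc_pieces (z t) : (T.pieces i T').arc z t =
    Sum.elim T.arc (fun b => (T.holeMap i).comp (T'.arc b)) (splitBegin s s₀ i s' z) t := rfl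

theorem support_pieces : (T.pieces i T').support = T.support ∪ T.hole i '' T'.support :=
  Strands.support_reindex.trans <| Strands.support_sum.trans <| congrArg _ Strands.support_map

theorem isPositivePath_pieces {γ : I → ℂ} : (T.pieces i T').IsPositivePath γ ↔
    T.IsPositivePath γ ∨ ∃ γ', T'.IsPositivePath γ' ∧ γ = T.hole i ∘ γ' :=
  Strands.isPositivePath_reindex.trans <| Strands.isPositivePath_sum.trans <|
    or_congr Iff.rfl Strands.isPositivePath_map

variable {T i T'} in
theorem eq_one_and_eq_zero_or_of_arc_eq_hole_arc {b t b' t'}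
    (h : T.arc b t = T.hole i (T'.arc b' t')) : (t = 1 ∧ t' = 0) ∨ t = 0 ∧ t' = 1 := by
  have hb' : ‖T'.arc b' t'‖ ≤ 1 :=
    norm_le_of_mem_support (T'.strands.mem_support_iff.mpr (.inl ⟨b', t', rfl⟩))
  obtain ⟨j, hj, hij⟩ := exists_of_hole_mem_support hb'
    (h ▸ T.strands.mem_support_iff.mpr (.inl ⟨b, t, rfl⟩))
  have hT : (t = 0 ∧ -(s i).sign j = 1) ∨ t = 1 ∧ -(s i).sign j = -1 :=
    arc_eq_boundaryPoint (h.trans hij)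
  have hT' : (t' = 0 ∧ (s i).sign j = 1) ∨ t' = 1 ∧ (s i).sign j = -1 :=
    arc_eq_boundaryPoint (m := .inl j) hj
  rcases hT with ⟨ht, hs⟩ | ⟨ht, hs⟩ <;> rcases hT' with ⟨ht', hs'⟩ | ⟨ht', hs'⟩
  · exact absurd (hs' ▸ hs) (by decide)
  · exact .inr ⟨ht, ht'⟩
  · exact .inl ⟨ht, ht'⟩
  · exact absurd (hs' ▸ hs) (by decide)

theorem weaklyEmbedded_pieces : (T.pieces i T').WeaklyEmbedded := by
  refine (T.strands_embedded.weaklyEmbedded.sum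
    (T'.strands_embedded.map T.hole_bijective.1).weaklyEmbedded
    (fun _ _ _ _ => eq_one_and_eq_zero_or_of_arc_eq_hole_arc) (fun l u h => ?_)
    fun l u h => ?_).reindex
  · rw [Strands.support_map] at h
    obtain ⟨w, hw, hwl⟩ := h
    exact T.hole_notMem_interior (norm_le_of_mem_support hw) (hwl ▸ T.loop_mem l u)
  · have hl := (T'.loop_mem l u).1
    obtain ⟨j, hj, -⟩ := exists_of_hole_mem_support hl.le h
    exact hl.ne (hj ▸ norm_markedPoint j)

theorem hasEndpoints_pieces : (T.pieces i T').HasEndpoints (T.markGluing i T')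
    ((T.comp i T'.toHoledDisc).beginPoint _ s₀) ((T.comp i T'.toHoledDisc).endPoint _ s₀)
    (T.gluedPoint i) where
  arc_zero z := by
    rw [← T.elim_beginPoint_splitBegin]
    rw [arc_pieces]
    rcases splitBegin s s₀ i s' z with b | b
    · exact T.arc_zero b
    · exact congrArg (T.hole i) (T'.arc_zero b)
  arc_one z := by
    rw [← T.elim_endPoint_splitEnd, markGluing, Equiv.trans_apply, Equiv.trans_apply,
      Equiv.apply_symm_apply]
    rw [arc_pieces]
    rcases splitBegin s s₀ i s' z with b | b
    · exact T.arc_one b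
    · exact congrArg (T.hole i) (T'.arc_one b)
  start_ne_end := HoledDisc.beginPoint_ne_endPoint _
  glued_ne_start g b h := HoledDisc.beginPoint_notMem_interior _ b
    (h ▸ T.gluedPoint_mem_interior_comp i T'.toHoledDisc g)
  glued_ne_end g e h := HoledDisc.endPoint_notMem_interior _ e
    (h ▸ T.gluedPoint_mem_interior_comp i T'.toHoledDisc g)
  glued_injective := T.gluedPoint_injective i

theorem support_pieces_subset : (T.pieces i T').support ⊆ (T.comp i T'.toHoledDisc).interior ∪
    (Set.range ((T.comp i T'.toHoledDisc).beginPoint (compInputs s i s') s₀) ∪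
      Set.range ((T.comp i T'.toHoledDisc).endPoint (compInputs s i s') s₀)) := by
  have hends := T.hasEndpoints_pieces i T'
  intro z hz
  rcases Strands.mem_support_iff.mp hz with ⟨a, t, rfl⟩ | ⟨l | l, u, rfl⟩
  · by_cases h0 : t = 0
    · rw [h0, hends.arc_zero]
      rcases a with b | g
      · exact .inr (.inl ⟨b, rfl⟩)
      · exact .inl (T.gluedPoint_mem_interior_comp i _ g)
    by_cases h1 : t = 1
    · rw [h1, hends.arc_one]
      rcases T.markGluing i T' a with e | g
      · exact .inr (.inr ⟨e, rfl⟩)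
      · exact .inl (T.gluedPoint_mem_interior_comp i _ g)
    rw [arc_pieces]
    rcases splitBegin s s₀ i s' a with b | b
    · exact .inl (T.interior_subset_comp _ (T.arc_mem b t h0 h1))
    · exact .inl (T.hole_mem_interior_comp_of_mem_interior _ (T'.arc_mem b t h0 h1))
  · exact .inl (T.interior_subset_comp _ (T.loop_mem l u))
  · exact .inl (T.hole_mem_interior_comp_of_mem_interior _ (T'.loop_mem l u))

theorem exists_isComp [Finite ι] [Finite κ] : ∃ T'', T.IsComp i T' T'' := by
  obtain ⟨A, Λ, S, _, hS, hglue⟩ := (T.weaklyEmbedded_pieces i T').exists_embedded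
  have hends := T.hasEndpoints_pieces i T'
  have hS_starts : S.starts = _ := hS.starts_diff_ends.symm.trans
    (hglue.starts_diff.trans hends.starts_diff_ends)
  have hS_ends : S.ends = _ := hS.ends_diff_starts.symm.trans
    (hglue.ends_diff.trans hends.ends_diff_starts)
  obtain ⟨T'', e, f, hdisc, hstrands⟩ := exists_of_embedded (T.comp i T'.toHoledDisc) hS
    hS_starts hS_ends <| by
      rw [hS_starts, hS_ends, hglue.support_eq]
      exact T.support_pieces_subset i T'
  have hpath {γ} (h : (T.pieces i T').IsPositivePath γ) : T''.strands.IsPositivePath γ :=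
    hstrands ▸ Strands.isPositivePath_reindex.mpr (hglue.isPositivePath h)
  refine ⟨T'', fun j z => ?_, fun m z => ?_, ?_,
    fun γ h => hpath ((T.isPositivePath_pieces i T').mpr (.inl h)),
    fun γ h => hpath ((T.isPositivePath_pieces i T').mpr (.inr ⟨γ, h, rfl⟩))⟩
  · rw [hdisc, T.comp_hole_inl]
  · rw [hdisc, T.comp_hole_inr]
  · rw [← support_pieces, ← hglue.support_eq, ← Strands.support_reindex, ← hstrands]
    rfl

end PlanarTangle

/-! ### The wiring of composites and of isotopic tangles -/

namespace PlanarTangle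

variable {ι κ : Type} {s : ι → SignSeq} {s₀ : SignSeq}

section Glued

variable {T : PlanarTangle s s₀} {G Λ : Type} {S : Strands ℂ (BeginMark s s₀ ⊕ G) Λ}
  {q : BeginMark s s₀ ⊕ G ≃ EndMark s s₀ ⊕ G} {p : G → ℂ}

theorem matching_eq_of_gluesAlong (h : S.GluesAlong q T.strands)
    (hends : S.HasEndpoints q (T.beginPoint s s₀) (T.endPoint s s₀) p) {b : BeginMark s s₀}
    {e : EndMark s s₀} (hbe : GlueLeads q b e) : T.matching b = e := by
  obtain ⟨z, c, hz, hb, he⟩ := h.exists_strand_of_glueLeads hbe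
  rw [hends.arc_zero] at hb
  rw [hends.arc_one, hz] at he
  exact T.matching_eq_of_mem_strand hb he

theorem circles_eq_of_gluesAlong [Finite ι] [Finite G] [Finite Λ] (h : S.GluesAlong q T.strands)
    (hends : S.HasEndpoints q (T.beginPoint s s₀) (T.endPoint s s₀) p) :
    T.circles = Nat.card Λ + glueCircles q := by
  rw [← h.card_loops fun z e hz => ?_, Nat.card_fin]
  refine ⟨T.matching.symm e, (T.arc_one _).trans ?_⟩
  rw [T.matching.apply_symm_apply, hends.arc_one, hz, Sum.elim_inl]

end Glued

namespace IsComp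

variable {T : PlanarTangle s s₀} {i : ι} {s' : κ → SignSeq} {T' : PlanarTangle s' (s i)}
  {T'' : PlanarTangle (compInputs s i s') s₀}

theorem toHoledDisc_eq (h : T.IsComp i T' T'') :
    T''.toHoledDisc = T.comp i T'.toHoledDisc := by
  refine HoledDisc.ext_of_hole ?_
  rintro (j | m) z
  · exact (h.1 j z).trans (T.comp_hole_inl i T'.toHoledDisc j z).symm
  · exact (h.2.1 m z).trans (T.comp_hole_inr i T'.toHoledDisc m z).symm

theorem hasEndpoints_pieces (h : T.IsComp i T' T'') : (T.pieces i T').HasEndpoints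
    (T.markGluing i T') (T''.beginPoint _ s₀) (T''.endPoint _ s₀) (T.gluedPoint i) :=
  h.toHoledDisc_eq ▸ T.hasEndpoints_pieces i T'

theorem gluesAlong_pieces (h : T.IsComp i T' T'') :
    (T.pieces i T').GluesAlong (T.markGluing i T') T''.strands where
  weaklyEmbedded := T.weaklyEmbedded_pieces i T'
  embedded := T''.strands_embedded
  end_eq_start_iff := h.hasEndpoints_pieces.end_eq_start_iff
  isPositivePath hγ := by
    rcases (T.isPositivePath_pieces i T').mp hγ with hγ | ⟨γ', hγ', rfl⟩
    · exact h.2.2.2.1 _ hγ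
    · exact h.2.2.2.2 γ' hγ'
  support_eq := h.2.2.1.trans (T.support_pieces i T').symm

theorem matching_eq (h : T.IsComp i T' T'') {b : BeginMark (compInputs s i s') s₀}
    {e : EndMark (compInputs s i s') s₀} (hbe : GlueLeads (T.markGluing i T') b e) :
    T''.matching b = e :=
  matching_eq_of_gluesAlong h.gluesAlong_pieces h.hasEndpoints_pieces hbe

theorem circles_eq [Finite ι] [Finite κ] (h : T.IsComp i T' T'') :
    T''.circles = T.circles + T'.circles + glueCircles (T.markGluing i T') := by
  simpa using circles_eq_of_gluesAlong h.gluesAlong_pieces h.hasEndpoints_pieces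

end IsComp

section Isotopy

variable {T T' : PlanarTangle s s₀} {f : ℂ ≃ₜ ℂ}

theorem image_boundaryPoint (hout : ∀ z, 1 ≤ ‖z‖ → f z = z)
    (hhole : ∀ i z, ‖z‖ ≤ 1 → f (T.hole i z) = T'.hole i z) (m : BoundaryMark s s₀) :
    f (T.boundaryPoint m) = T'.boundaryPoint m := by
  rcases m with j | ⟨i, j⟩
  · exact hout _ (norm_markedPoint j).ge
  · exact hhole i _ (norm_markedPoint j).le

theorem isPositivePath_map_strands (hpath : ∀ γ, T.IsPositivePath γ ↔ T'.IsPositivePath (f ∘ γ))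
    {γ : I → ℂ} : (T.strands.map (f : C(ℂ, ℂ))).IsPositivePath γ ↔ T'.strands.IsPositivePath γ := by
  rw [Strands.isPositivePath_map]
  constructor
  · rintro ⟨γ', hγ', rfl⟩
    exact (hpath γ').mp hγ'
  · intro hγ
    have hγ' : γ = f ∘ (f.symm ∘ γ) := funext fun t => (f.apply_symm_apply (γ t)).symm
    exact ⟨f.symm ∘ γ, (hpath _).mpr (hγ' ▸ hγ), hγ'⟩

/-- An isotopy presents `T'` as a gluing of the image of `T` without glued points. -/
theorem Isotopic.matching_eq_and_circles_eq [Finite ι] (h : T.Isotopic T') :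
    T'.matching = T.matching ∧ T'.circles = T.circles := by
  obtain ⟨h, -, -, hout, hhole, hpath⟩ := h
  have himage := image_boundaryPoint (hout 1) hhole
  let S : Strands ℂ (BeginMark s s₀ ⊕ Empty) (Fin T.circles) :=
    (T.strands.map (h 1 : C(ℂ, ℂ))).reindex (Equiv.sumEmpty _ _) (Equiv.refl _)
  let q : BeginMark s s₀ ⊕ Empty ≃ EndMark s s₀ ⊕ Empty := T.matching.sumCongr (Equiv.refl _)
  have hends : S.HasEndpoints q (T'.beginPoint s s₀) (T'.endPoint s s₀) Empty.elim :=
    { arc_zero := by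
        rintro (b | ⟨⟨⟩⟩)
        rw [Sum.elim_inl, T'.beginPoint_eq_boundaryPoint, ← himage,
          ← T.beginPoint_eq_boundaryPoint, ← T.arc_zero]
        rfl
      arc_one := by
        rintro (b | ⟨⟨⟩⟩)
        rw [show q (.inl b) = .inl (T.matching b) from rfl, Sum.elim_inl,
          T'.endPoint_eq_boundaryPoint, ← himage, ← T.endPoint_eq_boundaryPoint, ← T.arc_one]
        rfl
      start_ne_end := T'.beginPoint_ne_endPoint
      glued_ne_start := nofun
      glued_ne_end := nofun
      glued_injective := nofun }
  have hglue : S.GluesAlong q T'.strands :=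
    { weaklyEmbedded := (T.strands_embedded.map (h 1).injective).weaklyEmbedded.reindex
      embedded := T'.strands_embedded
      end_eq_start_iff := hends.end_eq_start_iff
      isPositivePath := fun hγ =>
        (isPositivePath_map_strands hpath).mp (Strands.isPositivePath_reindex.mp hγ)
      support_eq := by
        ext z
        simp only [S, Strands.support_reindex, Strands.mem_support_iff_exists_isPositivePath,
          isPositivePath_map_strands hpath] }
  constructor
  · ext1 b
    exact matching_eq_of_gluesAlong hglue hends ⟨.inl b, .refl, rfl⟩
  · simpa [glueCircles_eq_zero_of_isEmpty] using circles_eq_of_gluesAlong hglue hends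

end Isotopy

end PlanarTangle

/-! ### The underlying wiring diagrams of composites, renumbered tangles and isotopic tangles -/

section Relabel

variable {X Y G X' Y' G' : Type} {q : X ⊕ G ≃ Y ⊕ G} {q' : X' ⊕ G' ≃ Y' ⊕ G'}
  {eX : X ≃ X'} {eY : Y ≃ Y'} {eG : G ≃ G'}

theorem GlueLeads.relabel (hq : ∀ z, q' (eX.sumCongr eG z) = eY.sumCongr eG (q z)) {x : X} {y : Y}
    (h : GlueLeads q x y) : GlueLeads q' (eX x) (eY y) := by
  obtain ⟨z, hz, hy⟩ := h
  refine ⟨eX.sumCongr eG z, ?_, by rw [hq, hy]; rfl⟩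
  refine Relation.ReflTransGen.lift (eX.sumCongr eG) ?_ _ _ hz
  rintro z _ ⟨g, hg, rfl⟩
  exact ⟨eG g, by rw [hq, hg]; rfl, rfl⟩

theorem glueMatching_relabel [Finite G] [Finite G']
    (hq : ∀ z, q' (eX.sumCongr eG z) = eY.sumCongr eG (q z)) (x : X) :
    glueMatching q' (eX x) = eY (glueMatching q x) :=
  glueLeads_unique q' (glueLeads_exists q' (eX x)).choose_spec
    (GlueLeads.relabel hq (glueLeads_exists q x).choose_spec)

theorem glueCircles_relabel (hq : ∀ z, q' (eX.sumCongr eG z) = eY.sumCongr eG (q z)) :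
    glueCircles q' = glueCircles q := by
  have apply_inr (g) : q' (.inr (eG g)) = eY.sumCongr eG (q (.inr g)) := hq (.inr g)
  have step_iff (g g') : q (.inr g) = .inr g' ↔ q' (.inr (eG g)) = .inr (eG g') := by
    rw [apply_inr]
    rcases q (.inr g) with y | g₁ <;> simp
  have not_free_iff (g) :
      (∀ y', q' (.inr (eG g)) ≠ .inl y') ↔ ∀ y, q (.inr g) ≠ .inl y := by
    rw [apply_inr]
    rcases q (.inr g) with y | g₁ <;> simp
  let components : GluedPointComponent q ≃ GluedPointComponent q' := Quot.congr eG step_iff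
  refine (Nat.card_congr (components.subtypeEquiv fun K => ⟨fun h g' hg' => ?_,
    fun h g hg => ?_⟩)).symm
  · obtain ⟨g, rfl⟩ := eG.surjective g'
    exact (not_free_iff g).mpr (h g (components.injective hg'))
  · exact (not_free_iff g).mp (h (eG g) (congrArg components hg))

end Relabel

section Cast

variable {L ι : Type} {c₁ c₂ : ι → LabelPair L} {c₀ : LabelPair L}

/-- The bijection of labels of beginning points that is induced by an equality of label sets. -/
def castBegin (h : c₁ = c₂) : BeginLabel c₁ c₀ ≃ BeginLabel c₂ c₀ :=
  (Equiv.refl _).sumCongr (Equiv.sigmaCongrRight fun j => Equiv.cast (by rw [h]))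

/-- The bijection of labels of ending points that is induced by an equality of label sets. -/
def castEnd (h : c₁ = c₂) : EndLabel c₁ c₀ ≃ EndLabel c₂ c₀ :=
  (Equiv.refl _).sumCongr (Equiv.sigmaCongrRight fun j => Equiv.cast (by rw [h]))

namespace WiringDiagram

theorem matching_cast (h : c₁ = c₂) (D : WiringDiagram c₁ c₀) (x : BeginLabel c₁ c₀) :
    (D.cast h).matching (castBegin h x) = castEnd h (D.matching x) := by
  subst h
  have castBegin_rfl : castBegin (rfl : c₁ = c₁) x = x := by rcases x with x | ⟨j, x⟩ <;> rfl
  have castEnd_rfl (y : EndLabel c₁ c₀) : castEnd rfl y = y := by rcases y with y | ⟨j, y⟩ <;> rfl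
  rw [castBegin_rfl, castEnd_rfl]
  rfl

theorem circles_cast (h : c₁ = c₂) (D : WiringDiagram c₁ c₀) : (D.cast h).circles = D.circles := by
  subst h
  rfl

end WiringDiagram

theorem act_reindex_cast {k : Type u} [Field k] (A : CircuitAction.{w} k L) {t : ℕ} (h : c₁ = c₂)
    (D : WiringDiagram c₁ c₀) (e : ι ≃ Fin t) (x : ∀ z, A.V (c₁ z)) :
    A.act (D.reindex e) (fun j => x (e.symm j)) =
      A.act ((D.cast h).reindex e) fun j =>
        cast (congrArg (fun c => (A.V (c (e.symm j)) : Type w)) h) (x (e.symm j)) := by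
  subst h
  rfl

end Cast

section CompLabels

variable {L ι κ : Type} (ν : ℕ ↪ L) (s : ι → SignSeq) (s₀ : SignSeq) (i : ι) (s' : κ → SignSeq)

/-- The labels, in the composite of the wiring diagrams, of the marked points at which the strands
of a composite tangle begin. -/
noncomputable def compBeginLabelEquiv : BeginMark (compInputs s i s') s₀ ≃
    BeginLabel (Sum.elim (fun j : {j // j ≠ i} => (s j.1).labels ν) fun m => (s' m).labels ν)
      (s₀.labels ν) :=
  (beginLabelEquiv ν _ s₀).trans (castBegin (labels_comp_elim ν s i s'))

/-- The labels, in the composite of the wiring diagrams, of the marked points at which the strands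
of a composite tangle end. -/
noncomputable def compEndLabelEquiv : EndMark (compInputs s i s') s₀ ≃
    EndLabel (Sum.elim (fun j : {j // j ≠ i} => (s j.1).labels ν) fun m => (s' m).labels ν)
      (s₀.labels ν) :=
  (endLabelEquiv ν _ s₀).trans (castEnd (labels_comp_elim ν s i s'))

/-- The labels of the marked points along which two tangles are glued. -/
noncomputable def gluedLabelEquiv (a : SignSeq) :
    GluedMark a ≃ (a.labels ν).out ⊕ (a.labels ν).inn :=
  (labelsOfEquiv ν fun j => a.sign j = -1).sumCongr (labelsOfEquiv ν fun j => a.sign j = 1)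

theorem splitEquiv_beginLabel (z) :
    splitEquiv (fun a : LabelPair L => a.out) (s₀.labels ν).inn ((s i).labels ν).inn
        (fun j => (s j).labels ν) i (fun m => (s' m).labels ν)
        ((compBeginLabelEquiv ν s s₀ i s').sumCongr (gluedLabelEquiv ν (s i)) z) =
      (beginLabelEquiv ν s s₀).sumCongr (beginLabelEquiv ν s' (s i)) (splitBegin s s₀ i s' z) := by
  rcases z with (z | ⟨j | m, z⟩) | (z | z) <;> rfl

theorem splitEquiv_endLabel (z) :
    splitEquiv (fun a : LabelPair L => a.inn) (s₀.labels ν).out ((s i).labels ν).out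
        (fun j => (s j).labels ν) i (fun m => (s' m).labels ν)
        ((Equiv.refl _).sumCongr (Equiv.sumComm _ _)
          ((compEndLabelEquiv ν s s₀ i s').sumCongr (gluedLabelEquiv ν (s i)) z)) =
      (endLabelEquiv ν s s₀).sumCongr (endLabelEquiv ν s' (s i)) (splitEnd s s₀ i s' z) := by
  rcases z with (z | ⟨j | m, z⟩) | (z | z) <;> rfl

end CompLabels

namespace PlanarTangle

variable {L ι κ : Type} {s : ι → SignSeq} {s₀ : SignSeq} (ν : ℕ ↪ L)

theorem matching_forget (T : PlanarTangle s s₀) (b : BeginMark s s₀) :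
    (T.forget ν).matching (beginLabelEquiv ν s s₀ b) = endLabelEquiv ν s s₀ (T.matching b) := by
  simp [forget]

theorem Isotopic.forget_eq [Finite ι] {T T' : PlanarTangle s s₀} (h : T.Isotopic T') :
    T.forget ν = T'.forget ν := by
  obtain ⟨hmatching, hcircles⟩ := h.matching_eq_and_circles_eq
  exact WiringDiagram.ext (by simp only [forget, hmatching]) hcircles.symm

theorem forget_id (a : SignSeq) : (PlanarTangle.id a).forget ν = WiringDiagram.id (a.labels ν) := by
  refine WiringDiagram.ext (Equiv.ext fun x => ?_) rfl
  obtain ⟨b, rfl⟩ := (beginLabelEquiv ν _ _).surjective x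
  rw [matching_forget]
  rcases b with b | ⟨i, b⟩ <;> rfl

theorem forget_reindex (T : PlanarTangle s s₀) (e : ι ≃ κ) :
    (T.reindex e).forget ν = (T.forget ν).reindex e := by
  refine WiringDiagram.ext (Equiv.ext fun x => ?_) rfl
  obtain ⟨b, rfl⟩ := (beginLabelEquiv ν _ _).surjective x
  let beginMarks := (Equiv.refl {j : Fin s₀.len // s₀.sign j = 1}).sumCongr
    (e.symm.sigmaCongrLeft (β := fun i => {j : Fin (s i).len // (s i).sign j = -1}))
  let endMarks := (Equiv.refl {j : Fin s₀.len // s₀.sign j = -1}).sumCongr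
    (e.symm.sigmaCongrLeft (β := fun i => {j : Fin (s i).len // (s i).sign j = 1}))
  let beginLabels := (Equiv.refl (s₀.labels ν).inn).sumCongr
    (e.symm.sigmaCongrLeft (β := fun i => ((s i).labels ν).out))
  let endLabels := (Equiv.refl (s₀.labels ν).out).sumCongr
    (e.symm.sigmaCongrLeft (β := fun i => ((s i).labels ν).inn))
  refine endLabels.injective ?_
  calc
    _ = endLabels (endLabelEquiv ν _ s₀ (endMarks.symm (T.matching (beginMarks b)))) := by
      rw [matching_forget]
      rfl
    _ = endLabelEquiv ν s s₀ (endMarks (endMarks.symm (T.matching (beginMarks b)))) := by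
      rcases endMarks.symm (T.matching (beginMarks b)) with y | ⟨j, y⟩ <;> rfl
    _ = (T.forget ν).matching (beginLabelEquiv ν s s₀ (beginMarks b)) := by
      rw [Equiv.apply_symm_apply, matching_forget]
    _ = (T.forget ν).matching (beginLabels (beginLabelEquiv ν _ s₀ b)) := by
      rcases b with b | ⟨j, b⟩ <;> rfl
    _ = _ := (endLabels.apply_symm_apply _).symm

variable {i : ι} {s' : κ → SignSeq}

theorem gluingData_forget (T : PlanarTangle s s₀) (T' : PlanarTangle s' (s i)) (z) :
    (T.forget ν).gluingData i (T'.forget ν)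
        ((compBeginLabelEquiv ν s s₀ i s').sumCongr (gluedLabelEquiv ν (s i)) z) =
      (compEndLabelEquiv ν s s₀ i s').sumCongr (gluedLabelEquiv ν (s i))
        (T.markGluing i T' z) := by
  have sumCongr_matching (y) : (T.forget ν).matching.sumCongr (T'.forget ν).matching
      ((beginLabelEquiv ν s s₀).sumCongr (beginLabelEquiv ν s' (s i)) y) =
        (endLabelEquiv ν s s₀).sumCongr (endLabelEquiv ν s' (s i))
          (T.matching.sumCongr T'.matching y) := by
    rcases y with y | y
    · exact congrArg Sum.inl (T.matching_forget ν y)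
    · exact congrArg Sum.inr (T'.matching_forget ν y)
  have splitEnd_markGluing : T.matching.sumCongr T'.matching (splitBegin s s₀ i s' z) =
      splitEnd s s₀ i s' (T.markGluing i T' z) :=
    ((splitEnd s s₀ i s').apply_symm_apply _).symm
  rw [WiringDiagram.gluingData, Equiv.trans_apply, splitEquiv_beginLabel, Equiv.trans_apply,
    sumCongr_matching, splitEnd_markGluing, ← splitEquiv_endLabel, Equiv.trans_apply,
    Equiv.symm_apply_apply]
  rcases (compEndLabelEquiv ν s s₀ i s').sumCongr (gluedLabelEquiv ν (s i))
    (T.markGluing i T' z) with y | (y | y) <;> rfl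

theorem IsComp.forget_eq [Finite ι] [Finite κ] {T : PlanarTangle s s₀} {T' : PlanarTangle s' (s i)}
    {T'' : PlanarTangle (compInputs s i s') s₀} (h : T.IsComp i T' T'') :
    (T''.forget ν).cast (labels_comp_elim ν s i s') = (T.forget ν).comp i (T'.forget ν) := by
  refine WiringDiagram.ext (Equiv.ext fun x => ?_) ?_
  · obtain ⟨b, rfl⟩ := (compBeginLabelEquiv ν s s₀ i s').surjective x
    calc
      _ = compEndLabelEquiv ν s s₀ i s' (T''.matching b) :=
        (WiringDiagram.matching_cast _ _ _).trans (congrArg _ (T''.matching_forget ν b))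
      _ = compEndLabelEquiv ν s s₀ i s' (glueMatching (T.markGluing i T') b) :=
        congrArg _ (h.matching_eq (glueLeads_exists _ b).choose_spec)
      _ = _ := (glueMatching_relabel (gluingData_forget ν T T') b).symm
  · rw [WiringDiagram.circles_cast]
    exact h.circles_eq.trans
      (congrArg (T.circles + T'.circles + ·) (glueCircles_relabel (gluingData_forget ν T T')).symm)

end PlanarTangle

theorem IsCircuitAlgebra.restrictAction {L : Type} {k : Type u} [Field k] (ν : ℕ ↪ L)
    {A : CircuitAction.{w} k L} (hA : IsCircuitAlgebra A) :
    IsPlanarAlgebra ((restrictAction ν).obj A) where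
  isotopy _ _ h := congrArg (A.act ·) (h.forget_eq ν)
  unit a x := (congrArg (A.act · x) (PlanarTangle.forget_id ν a)).trans (hA.unit (a.labels ν) x)
  comp T i s' T' T'' e x h :=
    calc
      _ = A.act ((T''.forget ν).reindex e) fun j => x (e.symm j) :=
        congrArg (A.act · fun j => x (e.symm j)) (T''.forget_reindex ν e)
      _ = _ := act_reindex_cast A (labels_comp_elim ν _ i s') (T''.forget ν) e x
      _ = _ := by
        rw [h.forget_eq ν]
        exact hA.comp (T.forget ν) i (T'.forget ν) e fun z =>
          cast (congrArg (fun c => (A.V (c z) : Type w)) (labels_comp_elim ν _ i s')) (x z)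
  perm T e x :=
    (congrArg (A.act · fun j => x (e.symm j)) (T.forget_reindex ν e)).trans
      (hA.perm (T.forget ν) e x)

/-! ### The circuit algebra generated by a planar algebra -/

theorem apply_plug {ι : Type} [DecidableEq ι] {X Y : ι → Type*} (f : ∀ j, X j → Y j) (i : ι)
    (x : ∀ j : {j // j ≠ i}, X j.1) (v : X i) (j : ι) :
    f j (plug i x v j) = plug i (fun j => f j.1 (x j)) (f i v) j := by
  unfold plug
  split_ifs with h
  · subst h
    rfl
  · rfl

namespace PlanarAction

variable {k : Type u} [Field k] {L : Type} (ν : ℕ ↪ L) (A : PlanarAction.{max u w} k)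

/-- The formal expressions that can be formed from elements of `A` in a circuit algebra. -/
inductive Term : LabelPair L → Type (max u w)
  | of (s : SignSeq) (a : A.V s) : Term (s.labels ν)
  | zero (c : LabelPair L) : Term c
  | add {c : LabelPair L} (x y : Term c) : Term c
  | smul {c : LabelPair L} (a : k) (x : Term c) : Term c
  | act {r : ℕ} {c : Fin r → LabelPair L} {c₀ : LabelPair L} (D : WiringDiagram c c₀)
      (x : ∀ j, Term (c j)) : Term c₀

variable {ν A}

/-- The value of a formal expression in a circuit algebra. -/
noncomputable def Term.eval {B : CircuitAction.{max u w} k L} (f : A ⟶ (restrictAction ν).obj B) :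
    ∀ {c : LabelPair L}, Term.{w} ν A c → B.V c
  | _, .of s a => f.app s a
  | _, .zero _ => 0
  | _, .add x y => x.eval f + y.eval f
  | _, .smul a x => a • x.eval f
  | _, .act D x => B.act D fun j => (x j).eval f

variable (ν A)

/-- Two expressions are identified if they have the same value in every circuit algebra to which
`A` is mapped. -/
def termSetoid (c : LabelPair L) : Setoid (Term.{w} ν A c) where
  r x y := ∀ B : CircuitAction.{max u w} k L, IsCircuitAlgebra B →
    ∀ f : A ⟶ (restrictAction ν).obj B, x.eval f = y.eval f
  iseqv := ⟨fun _ _ _ _ => rfl, fun h B hB f => (h B hB f).symm,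
    fun h h' B hB f => (h B hB f).trans (h' B hB f)⟩

/-- The vector spaces of the circuit algebra generated by `A`. -/
def Generated (c : LabelPair L) : Type (max u w) := Quotient (termSetoid.{w} ν A c)

namespace Generated

variable {ν A} {c : LabelPair L}

/-- The class of a formal expression. -/
def mk (x : Term.{w} ν A c) : Generated.{w} ν A c := Quotient.mk _ x

noncomputable instance : Zero (Generated.{w} ν A c) := ⟨mk (.zero c)⟩

noncomputable instance : Add (Generated.{w} ν A c) :=
  ⟨Quotient.map₂ .add fun _ _ h _ _ h' B hB f => congrArg₂ (· + ·) (h B hB f) (h' B hB f)⟩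

noncomputable instance : SMul k (Generated.{w} ν A c) :=
  ⟨fun a => Quotient.map (.smul a) fun _ _ h B hB f => congrArg (a • ·) (h B hB f)⟩

/-- The operation of a wiring diagram on classes of formal expressions. -/
noncomputable def act {r : ℕ} {c : Fin r → LabelPair L} {c₀ : LabelPair L}
    (D : WiringDiagram c c₀) (x : ∀ j, Generated.{w} ν A (c j)) : Generated.{w} ν A c₀ :=
  mk (.act D fun j => (x j).out)

section Eval

variable {B : CircuitAction.{max u w} k L} (hB : IsCircuitAlgebra B)
  (f : A ⟶ (restrictAction ν).obj B)

/-- The value of a class of formal expressions in a circuit algebra. -/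
noncomputable def eval : Generated.{w} ν A c → B.V c :=
  Quotient.lift (Term.eval f) fun _ _ h => h B hB f

@[simp]
theorem eval_zero : eval hB f (0 : Generated.{w} ν A c) = 0 := rfl

@[simp]
theorem eval_add (x y : Generated.{w} ν A c) : eval hB f (x + y) = eval hB f x + eval hB f y :=
  Quotient.inductionOn₂ x y fun _ _ => rfl

@[simp]
theorem eval_smul (a : k) (x : Generated.{w} ν A c) : eval hB f (a • x) = a • eval hB f x :=
  Quotient.inductionOn x fun _ => rfl

theorem eval_act {r : ℕ} {c : Fin r → LabelPair L} {c₀ : LabelPair L} (D : WiringDiagram c c₀)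
    (x : ∀ j, Generated.{w} ν A (c j)) :
    eval hB f (act D x) = B.act D fun j => eval hB f (x j) :=
  congrArg (B.act D) (funext fun j => congrArg (eval hB f) (x j).out_eq)

theorem eval_act_update {r : ℕ} [DecidableEq (Fin r)] {c : Fin r → LabelPair L}
    {c₀ : LabelPair L} (D : WiringDiagram c c₀) (x : ∀ j, Generated.{w} ν A (c j)) (i : Fin r)
    (y : Generated.{w} ν A (c i)) :
    eval hB f (act D (Function.update x i y)) =
      B.act D (Function.update (fun j => eval hB f (x j)) i (eval hB f y)) := by
  rw [eval_act]
  exact congrArg (B.act D) (funext fun j => Function.apply_update (fun _ => eval hB f) x i y j)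

theorem eval_act_plug {r : ℕ} {c : Fin r → LabelPair L} {c₀ : LabelPair L}
    (D : WiringDiagram c c₀) (i : Fin r) (x : ∀ j : {j // j ≠ i}, Generated.{w} ν A (c j))
    (y : Generated.{w} ν A (c i)) :
    eval hB f (act D (plug (X := fun j => Generated.{w} ν A (c j)) i x y)) =
      B.act D (plug (X := fun j => B.V (c j)) i (fun j => eval hB f (x j)) (eval hB f y)) :=
  (eval_act hB f D _).trans
    (congrArg (B.act D) (funext (apply_plug (fun _ => eval hB f) i x y)))

end Eval

@[ext]
theorem ext {x y : Generated.{w} ν A c} (h : ∀ (B : CircuitAction.{max u w} k L)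
    (hB : IsCircuitAlgebra B) (f : A ⟶ (restrictAction ν).obj B), eval hB f x = eval hB f y) :
    x = y := by
  induction x, y using Quotient.inductionOn₂
  exact Quotient.sound h

theorem act_mk {r : ℕ} {c : Fin r → LabelPair L} {c₀ : LabelPair L} (D : WiringDiagram c c₀)
    (x : ∀ j, Term.{w} ν A (c j)) : act D (fun j => mk (x j)) = mk (.act D x) :=
  ext fun _ hB f => eval_act hB f D _

noncomputable instance : AddCommMonoid (Generated.{w} ν A c) where
  add_assoc x y z := by ext B hB f; simp only [eval_add, add_assoc]
  zero_add x := by ext B hB f; simp only [eval_add, eval_zero, zero_add]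
  add_zero x := by ext B hB f; simp only [eval_add, eval_zero, add_zero]
  add_comm x y := by ext B hB f; simp only [eval_add, add_comm]
  nsmul := nsmulRec

noncomputable instance : Module k (Generated.{w} ν A c) where
  one_smul x := by ext B hB f; simp
  mul_smul a b x := by ext B hB f; simp [mul_smul]
  smul_zero a := by ext B hB f; simp
  smul_add a x y := by ext B hB f; simp
  add_smul a b x := by ext B hB f; simp [add_smul]
  zero_smul x := by ext B hB f; simp

noncomputable instance : AddCommGroup (Generated.{w} ν A c) := Module.addCommMonoidToAddCommGroup k

end Generated

open Generated

/-- The circuit algebra generated by a planar algebra. -/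
noncomputable def generated : CircuitAction.{max u w} k L where
  V c := ModuleCat.of k (Generated.{w} ν A c)
  act _ _ _ D :=
    { toFun := Generated.act D
      map_update_add' := fun x i y z => Generated.ext fun B hB f => by
        simp only [eval_add, eval_act_update, MultilinearMap.map_update_add]
      map_update_smul' := fun x i a y => Generated.ext fun B hB f => by
        simp only [eval_smul, eval_act_update, MultilinearMap.map_update_smul] }

theorem isCircuitAlgebra_generated : IsCircuitAlgebra (generated.{w} ν A) where
  unit a x := Generated.ext fun _ hB f =>
    (eval_act hB f _ _).trans (hB.unit a fun j => eval hB f (x j))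
  comp D i _ D' e x := Generated.ext fun B hB f =>
    (eval_act hB f _ _).trans <| (hB.comp D i D' e fun z => eval hB f (x z)).trans <|
      (congrArg (fun y => B.act D (plug i _ y)) (eval_act hB f D' _).symm).trans
        (eval_act_plug hB f D i _ _).symm
  perm D e x := Generated.ext fun _ hB f =>
    (eval_act hB f _ _).trans
      ((hB.perm D e fun j => eval hB f (x j)).trans (eval_act hB f _ _).symm)

/-- The universal morphism from a planar algebra to the generated circuit algebra. -/
noncomputable def generatedUnit : A ⟶ (restrictAction ν).obj (generated.{w} ν A) where
  app s :=
    { toFun := fun a => Generated.mk (.of s a)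
      map_add' := fun a b => Quotient.sound fun _ _ f => (f.app s).map_add a b
      map_smul' := fun r a => Quotient.sound fun _ _ f => (f.app s).map_smul r a }
  comm _ _ _ T x :=
    (Quotient.sound fun _ _ f => f.comm T x).trans
      (act_mk (T.forget ν) fun j => .of _ (x j)).symm

variable {ν A}

/-- The morphism from the generated circuit algebra that extends a morphism from `A`. -/
noncomputable def generatedDesc {B : CircuitAction.{max u w} k L} (hB : IsCircuitAlgebra B)
    (f : A ⟶ (restrictAction ν).obj B) : generated.{w} ν A ⟶ B where
  app _ :=
    { toFun := eval hB f
      map_add' := eval_add hB f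
      map_smul' := eval_smul hB f }
  comm _ _ _ D x := eval_act hB f D x

theorem eval_generatedUnit_comp {B : CircuitAction.{max u w} k L} (g : generated.{w} ν A ⟶ B)
    {c : LabelPair L} (x : Term.{w} ν A c) :
    x.eval (generatedUnit ν A ≫ (restrictAction ν).map g) = g.app c (Generated.mk x) := by
  induction x with
  | of s a => rfl
  | zero c => exact (g.app c).map_zero.symm
  | add x y hx hy => exact (congrArg₂ (· + ·) hx hy).trans ((g.app _).map_add _ _).symm
  | smul a x hx => exact (congrArg (a • ·) hx).trans ((g.app _).map_smul _ _).symm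
  | act D x hx =>
    exact (congrArg (B.act D) (funext hx)).trans
      ((g.comm D _).symm.trans (congrArg (g.app _) (act_mk D x)))

/-- Morphisms from the generated circuit algebra are the same as morphisms from `A`. -/
noncomputable def generatedHomEquiv {B : CircuitAction.{max u w} k L} (hB : IsCircuitAlgebra B) :
    (generated.{w} ν A ⟶ B) ≃ (A ⟶ (restrictAction ν).obj B) where
  toFun g := generatedUnit ν A ≫ (restrictAction ν).map g
  invFun f := generatedDesc hB f
  left_inv g := OperadAction.Hom.ext <| funext fun _ => LinearMap.ext fun x =>
    Quotient.inductionOn x (eval_generatedUnit_comp g)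
  right_inv _ := rfl

end PlanarAction

theorem exists_leftAdjoint_restriction {k : Type u} [Field k] {L : Type} (ν : ℕ ↪ L)
    (h : ∀ A : CircuitAction.{max u w} k L, IsCircuitAlgebra A →
      IsPlanarAlgebra ((restrictAction ν).obj A)) :
    ∃ φ : PlanarAlgebra.{max u w} k ⥤ CircuitAlgebra.{max u w} k L,
      Nonempty (φ ⊣ restriction ν h) := by
  let φ (A : PlanarAlgebra.{max u w} k) : CircuitAlgebra.{max u w} k L :=
    ⟨PlanarAction.generated.{w} ν A.obj, PlanarAction.isCircuitAlgebra_generated ν A.obj⟩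
  let homEquiv A B : (φ A ⟶ B) ≃ (A ⟶ (restriction ν h).obj B) :=
    { toFun := fun g => ⟨PlanarAction.generatedHomEquiv B.property g.hom⟩
      invFun := fun f => ⟨(PlanarAction.generatedHomEquiv B.property).symm f.hom⟩
      left_inv := fun _ => InducedCategory.hom_ext (Equiv.symm_apply_apply _ _)
      right_inv := fun _ => InducedCategory.hom_ext (Equiv.apply_symm_apply _ _) }
  exact ⟨_, ⟨Adjunction.adjunctionOfEquivLeft homEquiv fun _ _ _ _ _ => rfl⟩⟩

theorem proposition3p4_general {k : Type u} [Field k] {L : Type} (ν : ℕ ↪ L) :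
    (∀ {ι κ : Type} [Finite ι] [Finite κ] {s : ι → SignSeq} {s₀ : SignSeq} (T : PlanarTangle s s₀)
      (i : ι) {s' : κ → SignSeq} (T' : PlanarTangle s' (s i)), ∃ T'', T.IsComp i T' T'') ∧
    (∀ {ι : Type} [Finite ι] {s : ι → SignSeq} {s₀ : SignSeq} (T T' : PlanarTangle s s₀),
      T.Isotopic T' → T.forget ν = T'.forget ν) ∧
    (∀ a : SignSeq, (PlanarTangle.id a).forget ν = WiringDiagram.id (a.labels ν)) ∧
    (∀ {ι κ : Type} [Finite ι] [Finite κ] {s : ι → SignSeq} {s₀ : SignSeq} (T : PlanarTangle s s₀)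
      (i : ι) {s' : κ → SignSeq} (T' : PlanarTangle s' (s i))
      (T'' : PlanarTangle (compInputs s i s') s₀), T.IsComp i T' T'' →
      (T''.forget ν).cast (labels_comp_elim ν s i s') = (T.forget ν).comp i (T'.forget ν)) ∧
    (∀ {ι κ : Type} {s : ι → SignSeq} {s₀ : SignSeq} (T : PlanarTangle s s₀) (e : ι ≃ κ),
      (T.reindex e).forget ν = (T.forget ν).reindex e) ∧
    ∃ h : ∀ A : CircuitAction.{max u w} k L, IsCircuitAlgebra A →
        IsPlanarAlgebra ((restrictAction ν).obj A),
      ∃ φ : PlanarAlgebra.{max u w} k ⥤ CircuitAlgebra.{max u w} k L,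
        Nonempty (φ ⊣ restriction ν h) :=
  ⟨fun T i _ T' => T.exists_isComp i T', fun _ _ h => h.forget_eq ν, PlanarTangle.forget_id ν,
    fun _ _ _ _ _ h => h.forget_eq ν, PlanarTangle.forget_reindex ν,
    fun _ hA => hA.restrictAction ν, exists_leftAdjoint_restriction.{w} ν _⟩

theorem proposition3p4 {k : Type u} [Field k] {L : Type} [Countable L] (ν : ℕ ↪ L) :
    -- composable planar tangles can be composed
    (∀ {r r' : ℕ} {s : Fin r → SignSeq} {s₀ : SignSeq} (T : PlanarTangle s s₀) (i : Fin r)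
      {s' : Fin r' → SignSeq} (T' : PlanarTangle s' (s i)), ∃ T'', T.IsComp i T' T'') ∧
    -- the wiring diagram of a tangle depends only on its isotopy class
    (∀ {r : ℕ} {s : Fin r → SignSeq} {s₀ : SignSeq} (T T' : PlanarTangle s s₀),
      T.Isotopic T' → T.forget ν = T'.forget ν) ∧
    -- and this assignment is compatible with units, compositions and the symmetric group actions
    (∀ a : SignSeq, (PlanarTangle.id a).forget ν = WiringDiagram.id (a.labels ν)) ∧
    (∀ {r r' : ℕ} {s : Fin r → SignSeq} {s₀ : SignSeq} (T : PlanarTangle s s₀) (i : Fin r)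
      {s' : Fin r' → SignSeq} (T' : PlanarTangle s' (s i))
      (T'' : PlanarTangle (Sum.elim (fun j : {j // j ≠ i} => s j.1) s') s₀), T.IsComp i T' T'' →
      (T''.forget ν).cast (labels_comp_elim ν s i s') = (T.forget ν).comp i (T'.forget ν)) ∧
    (∀ {r : ℕ} {s : Fin r → SignSeq} {s₀ : SignSeq} (T : PlanarTangle s s₀)
      (e : Equiv.Perm (Fin r)), (T.reindex e).forget ν = (T.forget ν).reindex e) ∧
    -- so that every circuit algebra restricts to a planar algebra, and restriction has a left adjoint
    ∃ h : ∀ A : CircuitAction.{max u w} k L, IsCircuitAlgebra A →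
        IsPlanarAlgebra ((restrictAction ν).obj A),
      ∃ φ : PlanarAlgebra.{max u w} k ⥤ CircuitAlgebra.{max u w} k L,
        Nonempty (φ ⊣ restriction ν h) := by
  obtain ⟨exists_comp, forget_isotopic, forget_id, forget_comp, forget_reindex, adjunction⟩ :=
    proposition3p4_general.{w} ν (k := k)
  exact ⟨exists_comp, forget_isotopic, forget_id, forget_comp, forget_reindex, adjunction⟩
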